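/- An environment on $\mathbb Z^2$ assigns to each site $x\in\mathbb Z^2$ a set $\mathcal G_x$ of allowed steps. Write $x\to y$ if there are $n\ge 0$ and $x=x_0,x_1,\dots,x_n=y$ with $x_{i+1}-x_i\in\mathcal G_{x_i}$ for $0\le i<n$, and put $\mathcal C_x=\{y: x\to y\}$ and $\mathcal M_x=\{y: x\to y\text{ and }y\to x\}$. The environment has a gigantic $\mathcal M$-component if there is an $x$ such that $\mathcal M_x$ is infinite and all nearest-neighbour connected components of $\mathbb Z^2\setminus\mathcal M_x$ are finite. Orthant model $(\mathrm{NE}\ \mathrm{SW})$ with parameter $p\in[0,1]$: independently for each $x\in\mathbb Z^2$, $\mathcal G_x=\{e_1,e_2\}$ with probability $p$ and $\mathcal G_x=\{-e_1,-e_2\}$ with probability $1-p$. Oriented triangular site percolation with parameter $p\in[0,1]$: independently for each $x\in\mathbb Z^2$, $x$ is open ($\mathcal G_x=\{-e_1,\,e_2,\,-e_1+e_2\}$) with probability $p$ and closed ($\mathcal G_x=\emptyset$) with probability $1-p$; its critical value $p_c^{\mathrm{OTSP}}$ is the infimum of the $p\in[0,1]$ for which $\mathcal C_o$ is infinite with positive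 probability, where $o$ is the origin. Theorem. For every $p\in[0,1]$ with $p^3+2p-1\ge 0$ and $(1-p)^3+2(1-p)-1\ge 0$, the orthant model with parameter $p$ has a gigantic $\mathcal M$-component almost surely. Moreover, $p_c^{\mathrm{OTSP}}\ge 0.5466$. -/

import Mathlib

open MeasureTheory ProbabilityTheory unitInterval

namespace DegenerateEnv

/-- Vertices of the planar lattice `ℤ²`. -/
abbrev Site : Type := ℤ × ℤ

/-- An environment attaches to every site `x` the set `G x` of steps allowed from `x`. -/
abbrev Env : Type := Site → Set Site

/-- `x` is connected to `y` in `G`: there are `n ≥ 0` and `x = x₀, x₁, …, xₙ = y` with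
`xᵢ₊₁ - xᵢ ∈ G xᵢ` for all `i < n`. -/
def Connects (G : Env) : Site → Site → Prop :=
  Relation.ReflTransGen fun a b => b - a ∈ G a

/-- The forward cluster `C_x = {y | x → y}`. -/
def forwardCluster (G : Env) (x : Site) : Set Site := {y | Connects G x y}

/-- The communicating class `M_x = {y | x → y and y → x}`. -/
def mutualCluster (G : Env) (x : Site) : Set Site := {y | Connects G x y ∧ Connects G y x}

/-- The nearest-neighbour graph on `ℤ²`. -/
def latticeGraph : SimpleGraph Site where
  Adj a b := |b.1 - a.1| + |b.2 - a.2| = 1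
  symm := ⟨fun a b h => by
    rw [abs_sub_comm a.1, abs_sub_comm a.2]
    exact h⟩
  loopless := ⟨fun a h => by simp at h⟩

/-- `G` has a gigantic `M`-component: some `M_x` is infinite and every nearest-neighbour connected
component of `ℤ² \ M_x` is finite. -/
def HasGiganticComponent (G : Env) : Prop :=
  ∃ x : Site, (mutualCluster G x).Infinite ∧
    ∀ K : (latticeGraph.induce (mutualCluster G x)ᶜ).ConnectedComponent, K.supp.Finite

/-- The law of the i.i.d. two-valued environment `(A₁ A₂)`: independently at each site, the local
environment is `A₁` with probability `p` and `A₂` with probability `1 - p`. -/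
noncomputable def twoValuedLaw (A₁ A₂ : Set Site) (p : I) : Measure Env :=
  Measure.infinitePi fun _ : Site => bernoulliMeasure A₁ A₂ p

/-- The steps `e₁`, `e₂` (right, up). -/
def stepsNE : Set Site := {(1, 0), (0, 1)}

/-- The steps `-e₁`, `-e₂` (left, down). -/
def stepsSW : Set Site := {(-1, 0), (0, -1)}

/-- The orthant model `(NE SW)`. -/
noncomputable def orthantLaw (p : I) : Measure Env := twoValuedLaw stepsNE stepsSW p

/-- The steps `-e₁`, `e₂`, `-e₁ + e₂` of the oriented triangular lattice. -/
def stepsTriangular : Set Site := {(-1, 0), (0, 1), (-1, 1)}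

/-- Oriented site percolation on the triangular lattice: open sites (probability `p`) connect to
their three out-neighbours, closed sites connect to nothing. -/
noncomputable def otspLaw (p : I) : Measure Env := twoValuedLaw stepsTriangular ∅ p

/-- The critical value of oriented triangular site percolation: the infimum of the `p ∈ [0, 1]`
for which the cluster of the origin is infinite with positive probability. -/
noncomputable def otspCritical : I :=
  sInf {p : I | 0 < otspLaw p {G | (forwardCluster G 0).Infinite}}

end DegenerateEnv

namespace DegenerateEnv

/-! Call F forward closed if no arrow leaves it. Forward clusters are forward closed, and so is the
set of sites that do not reach a given x. A site of F whose lower or left neighbour lies outside F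
must be `NE`, since otherwise an arrow would leave F. Following the lower boundary of F up and to
the left therefore traces an oriented triangular path through `NE` sites. If all triangular clusters
are finite, in both directions and for both site types, this walk must stop at a tip on either side
(`ForwardClosed.exists_tip`). Arrow paths inside F issuing from the two tips close off a finite
region (`ForwardClosed.exists_trap_of_path`), so every component of the complement of F is finite
(`ForwardClosed.exists_trap`).

If moreover boundary chains started far out on the axis do not come back to the diagonal, every
nonempty forward closed set meets one fixed finite segment (`exists_axis_hitting_bound`). Applied to
forward clusters, this gives an x reached from infinitely many sites. If some v did not reach x, the
set of such v would trap x together with its whole backward cluster in a finite set. Hence every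
site reaches x, and M_x = C_x is forward closed, infinite, and has finite complementary components.

The probabilistic input is exponential decay for triangular percolation with p ≤ 0.5467
(`measureReal_triConnects_le`). A path is explored column by column, and an exponential moment of
its height is compared with the moment one column earlier (`measureReal_reachesAbove_le`). With q =
1 - p, looking one closed site ahead gives nonpositive drift exactly when q³ + 2q - 1 ≥ 0. Looking
one site further leaves strict room, so the root p ≈ 0.54660 is covered as well. Decay for p and for
1 - p gives the orthant statement; decay for p alone gives the bound on the critical value. -/

/-! ### Boundary chains of forward closed sets -/

/-- Directed connections in the triangular lattice through sites of `P`; the endpoint need not lie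
in `P`. -/
def TriConnects (P : Set Site) : Site → Site → Prop :=
  Relation.ReflTransGen fun a b => a ∈ P ∧ b - a ∈ stepsTriangular

/-- All directed triangular clusters in `P` are finite. -/
def TriFinite (P : Set Site) : Prop := ∀ c, {z | TriConnects P c z}.Finite

/-- `F` is closed under the arrows of the orthant environment whose `NE` sites form `P`. -/
structure ForwardClosed (P F : Set Site) : Prop where
  right {x y : ℤ} : (x, y) ∈ F → (x, y) ∈ P → (x + 1, y) ∈ F
  up {x y : ℤ} : (x, y) ∈ F → (x, y) ∈ P → (x, y + 1) ∈ F
  left {x y : ℤ} : (x, y) ∈ F → (x, y) ∉ P → (x - 1, y) ∈ F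
  down {x y : ℤ} : (x, y) ∈ F → (x, y) ∉ P → (x, y - 1) ∈ F

theorem ForwardClosed.swap {P F : Set Site} (h : ForwardClosed P F) :
    ForwardClosed (Prod.swap ⁻¹' P) (Prod.swap ⁻¹' F) where
  right := h.up
  up := h.right
  left := h.down
  down := h.left

/-- Rotation by a half turn exchanges the two site types. It transfers results about the region
below F to the region above F. -/
theorem ForwardClosed.neg {P F : Set Site} (h : ForwardClosed P F) :
    ForwardClosed {v | -v ∉ P} {v | -v ∈ F} where
  right {x y} hF hP := by
    have := h.left (x := -x) (y := -y) hF hP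
    simpa [neg_add, sub_eq_add_neg, add_comm] using this
  up {x y} hF hP := by
    have := h.down (x := -x) (y := -y) hF hP
    simpa [neg_add, sub_eq_add_neg, add_comm] using this
  left {x y} hF hP := by
    have := h.right (x := -x) (y := -y) hF (not_not.1 hP)
    simpa [sub_eq_add_neg, add_comm] using this
  down {x y} hF hP := by
    have := h.up (x := -x) (y := -y) hF (not_not.1 hP)
    simpa [sub_eq_add_neg, add_comm] using this

theorem ForwardClosed.mem_of_up {P F : Set Site} (h : ForwardClosed P F) {x y : ℤ}
    (hd : (x, y) ∉ F) (hc : (x, y + 1) ∈ F) : (x, y + 1) ∈ P := by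
  by_contra hP
  have := h.down hc hP
  simp only [add_sub_cancel_right] at this
  exact hd this

theorem ForwardClosed.mem_of_right {P F : Set Site} (h : ForwardClosed P F) {x y : ℤ}
    (hd : (x, y) ∉ F) (hc : (x + 1, y) ∈ F) : (x + 1, y) ∈ P := by
  by_contra hP
  have := h.left hc hP
  simp only [add_sub_cancel_right] at this
  exact hd this

/-- The sites outside `F` whose upper right diagonal neighbour is in `F`. -/
def layer (F : Set Site) : Set Site := {v | v ∉ F ∧ (v.1 + 1, v.2 + 1) ∈ F}

/-- A unit step up or left inside `layer F`. -/
def LayerStep (F : Set Site) (a b : Site) : Prop :=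
  (b = (a.1, a.2 + 1) ∨ b = (a.1 - 1, a.2)) ∧ a ∈ layer F ∧ b ∈ layer F

/-- The walk hugs F from below. Its companion c' is the adjacent boundary site of F, which is `NE`
and is reached from c by a triangular path. Each move raises y - x by one or two, while finiteness
of the cluster of c bounds y - x by M + 1, so n serves as fuel. -/
theorem ForwardClosed.exists_tip_aux {P F : Set Site} (h : ForwardClosed P F) {c : Site} {M : ℤ}
    (hM : ∀ z, TriConnects P c z → z.2 - z.1 ≤ M) (n : ℕ) :
    ∀ (x y : ℤ) (c' : Site), TriConnects P c c' → (x, y) ∉ F → c' ∈ F →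
      (c' = (x, y + 1) ∨ c' = (x + 1, y)) → M + 1 - (y - x) < n →
      ∃ u v, Relation.ReflTransGen (LayerStep F) (x, y) (u, v) ∧ (u, v) ∉ F ∧ (u, v + 1) ∈ F ∧
        (u - 1, v) ∈ F ∧ TriConnects P c (u, v + 1) := by
  induction n with
  | zero =>
    intro x y c' hc' _ _ hxy hn
    have := hM c' hc'
    rcases hxy with rfl | rfl <;> simp at this hn <;> omega
  | succ n ih =>
    intro x y c' hc' hd hcF hxy hn
    push_cast at hn
    have hcP : c' ∈ P := by
      rcases hxy with rfl | rfl
      · exact h.mem_of_up hd hcF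
      · exact h.mem_of_right hd hcF
    have hlay : (x, y) ∈ layer F := by
      refine ⟨hd, ?_⟩
      rcases hxy with rfl | rfl
      · exact h.right hcF hcP
      · exact h.up hcF hcP
    by_cases hup : (x, y + 1) ∈ F
    · have hc2 : TriConnects P c (x, y + 1) := by
        rcases hxy with rfl | rfl
        · exact hc'
        · refine hc'.tail ⟨hcP, ?_⟩
          simp [stepsTriangular]
      have hP2 := h.mem_of_up hd hup
      by_cases hl : (x - 1, y) ∈ F
      · exact ⟨x, y, .refl, hd, hup, hl, hc2⟩
      have hl1 : (x - 1, y) ∈ layer F := ⟨hl, by simpa using hup⟩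
      have hs1 : LayerStep F (x, y) (x - 1, y) := ⟨Or.inr rfl, hlay, hl1⟩
      by_cases hlu : (x - 1, y + 1) ∈ F
      · obtain ⟨u, v, h1, h2⟩ := ih (x - 1) y (x - 1, y + 1)
          (hc2.tail ⟨hP2, by simp [stepsTriangular]⟩) hl hlu (Or.inl rfl) (by omega)
        exact ⟨u, v, h1.head hs1, h2⟩
      -- Here the boundary turns a corner: two layer steps are taken around (x, y + 1), which stays
      -- the companion.
      · have hs2 : LayerStep F (x - 1, y) (x - 1, y + 1) :=
          ⟨Or.inl rfl, hl1, hlu, by simpa using h.up hup hP2⟩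
        obtain ⟨u, v, h1, h2⟩ := ih (x - 1) (y + 1) (x, y + 1) hc2 hlu hup (Or.inr (by simp))
          (by omega)
        exact ⟨u, v, (h1.head hs2).head hs1, h2⟩
    · have hc3 : c' = (x + 1, y) := by
        rcases hxy with rfl | rfl
        · exact absurd hcF hup
        · rfl
      subst hc3
      have hF2 := h.up hcF hcP
      have hP2 := h.mem_of_right hup hF2
      have hs : LayerStep F (x, y) (x, y + 1) := ⟨Or.inl rfl, hlay, hup, h.up hF2 hP2⟩
      obtain ⟨u, v, h1, h2⟩ := ih x (y + 1) (x + 1, y + 1)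
        (hc'.tail ⟨hcP, by simp [stepsTriangular]⟩) hup hF2 (Or.inr rfl) (by omega)
      exact ⟨u, v, h1.head hs, h2⟩

theorem ForwardClosed.exists_tip {P F : Set Site} (h : ForwardClosed P F) (hfin : TriFinite P)
    {x y : ℤ} {c : Site} (hd : (x, y) ∉ F) (hc : c ∈ F) (hxy : c = (x, y + 1) ∨ c = (x + 1, y)) :
    ∃ u v, Relation.ReflTransGen (LayerStep F) (x, y) (u, v) ∧ (u, v) ∉ F ∧ (u, v + 1) ∈ F ∧
      (u - 1, v) ∈ F ∧ TriConnects P c (u, v + 1) := by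
  obtain ⟨M, hM⟩ := ((hfin c).image fun z => z.2 - z.1).bddAbove
  refine h.exists_tip_aux (c := c) (M := M) (fun z hz => hM ⟨z, hz, rfl⟩)
    (M + 2 - (y - x)).toNat x y c .refl hd hc hxy ?_
  omega

theorem layerStep_swap {F : Set Site} {a b : Site}
    (h : LayerStep (Prod.swap ⁻¹' F) a b) : LayerStep F b.swap a.swap := by
  obtain ⟨h1, h2, h3⟩ := h
  refine ⟨?_, h3, h2⟩
  rcases h1 with rfl | rfl
  · right; ext <;> simp
  · left; ext <;> simp

theorem exists_layerPath_extend {F : Set Site} {δ : ℕ → Site} {n : ℕ}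
    (hδ : ∀ i < n, LayerStep F (δ i) (δ (i + 1))) {b : Site}
    (hb : Relation.ReflTransGen (LayerStep F) (δ n) b) :
    ∃ (m : ℕ) (δ' : ℕ → Site), n ≤ m ∧ (∀ i ≤ n, δ' i = δ i) ∧ δ' m = b ∧
      ∀ i < m, LayerStep F (δ' i) (δ' (i + 1)) := by
  induction hb with
  | refl => exact ⟨n, δ, le_rfl, fun _ _ => rfl, rfl, hδ⟩
  | @tail b c _ hbc ih =>
    obtain ⟨m, δ', hnm, h1, h2, h3⟩ := ih
    refine ⟨m + 1, fun i => if i ≤ m then δ' i else c, by omega, ?_, by simp, ?_⟩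
    · intro i hi
      simp [h1 i hi, hi.trans hnm]
    · intro i hi
      rcases Nat.lt_or_ge i m with him | him
      · simpa [him.le, Nat.succ_le_of_lt him] using h3 i him
      · obtain rfl : i = m := by omega
        simpa [h2] using hbc

/-! ### Staircases and finite traps -/

/-- From a site of a forward closed set there is a staircase to the lower right in that set. -/
theorem ForwardClosed.exists_lower_staircase {P F : Set Site} (h : ForwardClosed P F) {a : Site}
    (ha : a ∈ F) : ∃ γ : ℕ → Site, γ 0 = a ∧ ∀ n, γ n ∈ F ∧
      ((γ n ∈ P ∧ γ (n + 1) = ((γ n).1 + 1, (γ n).2)) ∨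
        (γ n ∉ P ∧ γ (n + 1) = ((γ n).1, (γ n).2 - 1))) := by
  classical
  -- Every site has exactly one arrow that lowers y - x, and exactly one that raises it. A staircase
  -- thus follows arrows and visits successive diagonals once each.
  let f : Site → Site := fun v => if v ∈ P then (v.1 + 1, v.2) else (v.1, v.2 - 1)
  have hf : ∀ v ∈ F, f v ∈ F := by
    rintro ⟨x, y⟩ hv
    by_cases hP : (x, y) ∈ P
    · simpa [f, hP] using h.right hv hP
    · simpa [f, hP] using h.down hv hP
  refine ⟨fun n => f^[n] a, rfl, fun n => ⟨?_, ?_⟩⟩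
  · induction n with
    | zero => exact ha
    | succ n ih => simpa only [Function.iterate_succ_apply'] using hf _ ih
  · simp only [Function.iterate_succ_apply']
    by_cases hP : f^[n] a ∈ P
    · exact Or.inl ⟨hP, by simp [f, hP]⟩
    · exact Or.inr ⟨hP, by simp [f, hP]⟩

/-- From a site of a forward closed set there is a staircase to the upper left in that set. -/
theorem ForwardClosed.exists_upper_staircase {P F : Set Site} (h : ForwardClosed P F) {a : Site}
    (ha : a ∈ F) : ∃ γ : ℕ → Site, γ 0 = a ∧ ∀ n, γ n ∈ F ∧
      ((γ n ∈ P ∧ γ (n + 1) = ((γ n).1, (γ n).2 + 1)) ∨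
        (γ n ∉ P ∧ γ (n + 1) = ((γ n).1 - 1, (γ n).2))) := by
  obtain ⟨γ, h0, h1⟩ := h.swap.exists_lower_staircase (a := a.swap) (by simpa using ha)
  refine ⟨fun n => (γ n).swap, by simp [h0], fun n => ⟨(h1 n).1, ?_⟩⟩
  rcases (h1 n).2 with ⟨h2, h3⟩ | ⟨h2, h3⟩
  · exact Or.inl ⟨h2, by simp [h3]⟩
  · exact Or.inr ⟨h2, by simp [h3]⟩

/-- `U` is closed under nearest-neighbour steps that avoid `F`. -/
def Traps (F U : Set Site) : Prop := ∀ v ∈ U, ∀ u, latticeGraph.Adj v u → u ∉ F → u ∈ U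

theorem finite_of_bounds {U : Set Site} (a b c d : ℤ)
    (h : ∀ v ∈ U, a ≤ v.2 - v.1 ∧ v.2 - v.1 ≤ b ∧ c ≤ v.1 + v.2 ∧ v.1 + v.2 ≤ d) : U.Finite := by
  refine (Set.finite_Icc (((c - b) / 2, (a + c) / 2) : ℤ × ℤ)
    ((d - a) / 2, (b + d) / 2)).subset ?_
  rintro ⟨x, y⟩ hv
  have := h _ hv
  simp only [Set.mem_Icc, Prod.mk_le_mk] at this ⊢
  omega

/-- Discrete continuity on neighbouring diagonals: both heights x + y change by one, so their
difference changes by 0 or ±2. The order can then fail only at u = d' + (1, 1), which is excluded;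
the next lemma is the strict analogue. -/
theorem le_of_unit_steps {v u d d' : Site} (hv : v.2 - v.1 = d.2 - d.1)
    (hu : u.2 - u.1 = d'.2 - d'.1)
    (huv : u.1 + u.2 = v.1 + v.2 + 1 ∨ u.1 + u.2 = v.1 + v.2 - 1)
    (hdd : d'.1 + d'.2 = d.1 + d.2 + 1 ∨ d'.1 + d'.2 = d.1 + d.2 - 1)
    (hle : v.1 + v.2 ≤ d.1 + d.2) (hne : ¬(d'.1 + 1 = u.1 ∧ d'.2 + 1 = u.2)) :
    u.1 + u.2 ≤ d'.1 + d'.2 := by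
  have : u.1 + u.2 ≠ d'.1 + d'.2 + 2 := fun h => hne ⟨by omega, by omega⟩
  omega

theorem lt_of_unit_steps {v u d d' : Site} (hv : v.2 - v.1 = d.2 - d.1)
    (hu : u.2 - u.1 = d'.2 - d'.1)
    (huv : u.1 + u.2 = v.1 + v.2 + 1 ∨ u.1 + u.2 = v.1 + v.2 - 1)
    (hdd : d'.1 + d'.2 = d.1 + d.2 + 1 ∨ d'.1 + d'.2 = d.1 + d.2 - 1)
    (hlt : d.1 + d.2 < v.1 + v.2) (hne : ¬(d'.1 = u.1 ∧ d'.2 = u.2)) :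
    d'.1 + d'.2 < u.1 + u.2 := by
  have : u.1 + u.2 ≠ d'.1 + d'.2 := fun h => hne ⟨by omega, by omega⟩
  omega

theorem latticeGraph_adj_cases {v u : Site} (h : latticeGraph.Adj v u) :
    (u.1 = v.1 + 1 ∧ u.2 = v.2) ∨ (u.1 = v.1 - 1 ∧ u.2 = v.2) ∨ (u.1 = v.1 ∧ u.2 = v.2 + 1) ∨
      (u.1 = v.1 ∧ u.2 = v.2 - 1) := by
  have h' : |u.1 - v.1| + |u.2 - v.2| = 1 := h
  rcases abs_cases (u.1 - v.1) with h1 | h1 <;> rcases abs_cases (u.2 - v.2) with h2 | h2 <;> omega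

set_option maxHeartbeats 1000000 in
/-- A path in the layer below `F` between two tips, together with the staircases from the tips,
bounds a finite region. -/
theorem ForwardClosed.exists_trap_of_path {P F : Set Site} (hF : ForwardClosed P F)
    {δ : ℕ → Site} {L : ℕ} (hδ : ∀ i < L, LayerStep F (δ i) (δ (i + 1)))
    (hlay : ∀ i ≤ L, δ i ∈ layer F)
    (h1 : ((δ L).1, (δ L).2 + 1) ∈ F) (h2 : ((δ L).1 - 1, (δ L).2) ∈ F)
    (h3 : ((δ 0).1 + 1, (δ 0).2) ∈ F) (h4 : ((δ 0).1, (δ 0).2 - 1) ∈ F) :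
    ∃ U : Set Site, U.Finite ∧ Traps F U ∧ (∀ i ≤ L, δ i ∈ U) ∧
      ∀ v ∈ U, (δ 0).2 - (δ 0).1 ≤ v.2 - v.1 := by
  obtain ⟨α, hα0, hα⟩ := hF.exists_lower_staircase h2
  obtain ⟨β, hβ0, hβ⟩ := hF.exists_upper_staircase h4
  have hneF : ∀ v ∈ F, ∀ n ≤ L, ¬(v.1 = (δ n).1 ∧ v.2 = (δ n).2) := by
    intro v hv n hn h
    rw [Prod.ext h.1 h.2] at hv
    exact (hlay n hn).1 hv
  have hstep : ∀ i < L, ((δ (i + 1)).1 = (δ i).1 ∧ (δ (i + 1)).2 = (δ i).2 + 1) ∨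
      ((δ (i + 1)).1 = (δ i).1 - 1 ∧ (δ (i + 1)).2 = (δ i).2) := by
    intro i hi
    rcases (hδ i hi).1 with h | h <;> simp [h]
  have hαs : ∀ i, ((α (i + 1)).1 = (α i).1 + 1 ∧ (α (i + 1)).2 = (α i).2) ∨
      ((α (i + 1)).1 = (α i).1 ∧ (α (i + 1)).2 = (α i).2 - 1) := by
    intro i
    rcases (hα i).2 with h | h <;> simp [h.2]
  have hβs : ∀ i, ((β (i + 1)).1 = (β i).1 ∧ (β (i + 1)).2 = (β i).2 + 1) ∨
      ((β (i + 1)).1 = (β i).1 - 1 ∧ (β (i + 1)).2 = (β i).2) := by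
    intro i
    rcases (hβ i).2 with h | h <;> simp [h.2]
  have tδ : ∀ i ≤ L, (δ i).2 - (δ i).1 = (δ 0).2 - (δ 0).1 + i := by
    intro i
    induction i with
    | zero => simp
    | succ i ih => intro hi; have := ih (by omega); have := hstep i (by omega); push_cast; omega
  have tα : ∀ i, (α i).2 - (α i).1 = (δ 0).2 - (δ 0).1 + L + 1 - i := by
    intro i
    induction i with
    | zero => have := tδ L le_rfl; simp [hα0]; omega
    | succ i ih => have := hαs i; push_cast; omega
  have tβ : ∀ i, (β i).2 - (β i).1 = (δ 0).2 - (δ 0).1 - 1 + i := by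
    intro i
    induction i with
    | zero => simp [hβ0]; omega
    | succ i ih => have := hβs i; push_cast; omega
  -- The first step of α cannot go right, since that would put the tip into F; so α passes
  -- diagonally below the tip. The same holds for β at the other tip.
  have hα1 : (α 1).1 = (δ L).1 - 1 ∧ (α 1).2 = (δ L).2 - 1 := by
    rcases (hα 0).2 with h | h
    · exfalso
      have := (hα 1).1
      rw [show (1 : ℕ) = 0 + 1 from rfl, h.2, hα0] at this
      exact hneF _ this L le_rfl (by simp)
    · rw [show (1 : ℕ) = 0 + 1 from rfl, h.2, hα0]; simp
  have hβ1 : (β 1).1 = (δ 0).1 - 1 ∧ (β 1).2 = (δ 0).2 - 1 := by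
    rcases (hβ 0).2 with h | h
    · exfalso
      have := (hβ 1).1
      rw [show (1 : ℕ) = 0 + 1 from rfl, h.2, hβ0] at this
      exact hneF _ this 0 (by omega) (by simp)
    · rw [show (1 : ℕ) = 0 + 1 from rfl, h.2, hβ0]; simp
  -- On a common diagonal the heights of a staircase and of δ have equal parity. They never
  -- coincide, as δ avoids F, so the staircase remains strictly below δ.
  have hα_lt : ∀ n' n, n + n' = L → (α (n' + 1)).1 + (α (n' + 1)).2 < (δ n).1 + (δ n).2 := by
    intro n'
    induction n' with
    | zero => intro n hn; obtain rfl : n = L := by omega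
              simp only [zero_add]; omega
    | succ n' ih =>
      intro n hn
      have e1 := ih (n + 1) (by omega)
      have e2 := hstep n (by omega)
      have e3 := hαs (n' + 1)
      have e4 := tδ n (by omega)
      have e5 := tα (n' + 1 + 1)
      have e6 := tα (n' + 1)
      have e7 := tδ (n + 1) (by omega)
      have e8 := hneF _ (hα (n' + 1 + 1)).1 n (by omega)
      push_cast at *
      omega
  have hβ_lt : ∀ n, n ≤ L → (β (n + 1)).1 + (β (n + 1)).2 < (δ n).1 + (δ n).2 := by
    intro n
    induction n with
    | zero => intro hn; simp only [zero_add]; omega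
    | succ n ih =>
      intro hn
      have e1 := ih (by omega)
      have e2 := hstep n (by omega)
      have e3 := hβs (n + 1)
      have e4 := tδ n (by omega)
      have e5 := tβ (n + 1 + 1)
      have e6 := tβ (n + 1)
      have e7 := tδ (n + 1) (by omega)
      have e8 := hneF _ (hβ (n + 1 + 1)).1 (n + 1) (by omega)
      push_cast at *
      omega
  have hδb : ∀ n ≤ L, (δ n).1 + (δ n).2 ≤ (δ 0).1 + (δ 0).2 + n := by
    intro n
    induction n with
    | zero => simp
    | succ n ih => intro hn; have := ih (by omega); have := hstep n (by omega); push_cast; omega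
  have hβb : ∀ n, (β 0).1 + (β 0).2 - n ≤ (β n).1 + (β n).2 := by
    intro n
    induction n with
    | zero => simp
    | succ n ih => have := hβs n; push_cast; omega
  -- The trap consists of the sites on the diagonals met by δ that lie weakly below δ and strictly
  -- above both staircases. The indices n' + 1 and n + 1 put α and β on the diagonal of δ n.
  refine ⟨{v | ∃ n n' : ℕ, n + n' = L ∧ v.2 - v.1 = (δ 0).2 - (δ 0).1 + n ∧
      v.1 + v.2 ≤ (δ n).1 + (δ n).2 ∧ (α (n' + 1)).1 + (α (n' + 1)).2 < v.1 + v.2 ∧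
      (β (n + 1)).1 + (β (n + 1)).2 < v.1 + v.2}, ?_, ?_, ?_, ?_⟩
  · refine finite_of_bounds ((δ 0).2 - (δ 0).1) ((δ 0).2 - (δ 0).1 + L)
      ((β 0).1 + (β 0).2 - L - 1) ((δ 0).1 + (δ 0).2 + L) ?_
    rintro v ⟨n, n', hn, e1, e2, e3, e4⟩
    have := hδb n (by omega)
    have := hβb (n + 1)
    push_cast at this
    omega
  · rintro v ⟨n, n', hn, e1, e2, e3, e4⟩ u huv huF
    have hadj := latticeGraph_adj_cases huv
    have huF' : ∀ w ∈ F, ¬(w.1 = u.1 ∧ w.2 = u.2) := by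
      intro w hw h
      rw [Prod.ext h.1 h.2] at hw
      exact huF hw
    have tn := tδ n (by omega)
    have tn1 := tα (n' + 1)
    have tn2 := tβ (n + 1)
    rcases (by omega : u.2 - u.1 = v.2 - v.1 + 1 ∨ u.2 - u.1 = v.2 - v.1 - 1) with ht | ht
    -- On the last diagonal only the tip itself lies in the trap, and both of its exits to a higher
    -- diagonal are in F.
    · rcases Nat.eq_zero_or_pos n' with rfl | hn'
      · exfalso
        obtain rfl : n = L := by omega
        have e5 := huF' _ h1
        have e6 := huF' _ h2
        simp only [zero_add] at *
        omega
      · obtain ⟨m, rfl⟩ : ∃ m, n' = m + 1 := ⟨n' - 1, by omega⟩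
        have f1 := hstep n (by omega)
        have f2 := hαs (m + 1)
        have f3 := hβs (n + 1)
        have f4 := tδ (n + 1) (by omega)
        have f5 := tα (m + 1)
        have f6 := tβ (n + 1 + 1)
        have f7 := huF' _ (hlay (n + 1) (by omega)).2
        have f8 := huF' _ (hα (m + 1)).1
        have f9 := huF' _ (hβ (n + 1 + 1)).1
        push_cast at *
        have huv : u.1 + u.2 = v.1 + v.2 + 1 ∨ u.1 + u.2 = v.1 + v.2 - 1 := by clear * - hadj; omega
        refine ⟨n + 1, m, by omega, by push_cast; omega,
          le_of_unit_steps (v := v) (d := δ n) ?_ ?_ huv ?_ e2 f7,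
          lt_of_unit_steps (v := v) (d := α (m + 1 + 1)) ?_ ?_ huv ?_ e3 f8,
          lt_of_unit_steps (v := v) (d := β (n + 1)) ?_ ?_ huv ?_ e4 f9⟩ <;>
        clear hadj huv f7 f8 f9 <;> omega
    · rcases Nat.eq_zero_or_pos n with rfl | hn'
      · exfalso
        have e5 := huF' _ h3
        have e6 := huF' _ h4
        simp only [zero_add] at *
        omega
      · obtain ⟨m, rfl⟩ : ∃ m, n = m + 1 := ⟨n - 1, by omega⟩
        have f1 := hstep m (by omega)
        have f2 := hαs (n' + 1)
        have f3 := hβs (m + 1)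
        have f4 := tδ m (by omega)
        have f5 := tα (n' + 1 + 1)
        have f6 := tβ (m + 1)
        have f7 := huF' _ (hlay m (by omega)).2
        have f8 := huF' _ (hα (n' + 1 + 1)).1
        have f9 := huF' _ (hβ (m + 1)).1
        push_cast at *
        have huv : u.1 + u.2 = v.1 + v.2 + 1 ∨ u.1 + u.2 = v.1 + v.2 - 1 := by clear * - hadj; omega
        refine ⟨m, n' + 1, by omega, by omega,
          le_of_unit_steps (v := v) (d := δ (m + 1)) ?_ ?_ huv ?_ e2 f7,
          lt_of_unit_steps (v := v) (d := α (n' + 1)) ?_ ?_ huv ?_ e3 f8,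
          lt_of_unit_steps (v := v) (d := β (m + 1 + 1)) ?_ ?_ huv ?_ e4 f9⟩ <;>
        clear hadj huv f7 f8 f9 <;> omega
  · intro i hi
    refine ⟨i, L - i, by omega, tδ i hi, le_rfl, hα_lt _ _ (by omega), hβ_lt i hi⟩
  · rintro v ⟨n, n', hn, e1, -⟩
    omega

/-- A site just below a forward closed set whose boundary chains are finite is trapped. -/
theorem ForwardClosed.exists_trap_below {P F : Set Site} (hF : ForwardClosed P F)
    (hfin : TriFinite P) (hfin' : TriFinite (Prod.swap ⁻¹' P)) {x y : ℤ} (hd : (x, y) ∉ F)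
    (hc : (x, y + 1) ∈ F) :
    ∃ U : Set Site, U.Finite ∧ Traps F U ∧ (x, y) ∈ U ∧
      ∃ z ∈ Prod.swap ⁻¹' P, TriConnects (Prod.swap ⁻¹' P) (y + 1, x) z ∧
        ∀ v ∈ U, z.1 - z.2 < v.2 - v.1 := by
  obtain ⟨u, v, h1, h2, h3, h4, -⟩ := hF.exists_tip hfin hd hc (Or.inl rfl)
  -- Reflection in the diagonal gives the lower right tip. The end z of this second chain is kept
  -- because it lies on a lower diagonal than the whole trap.
  obtain ⟨q, p, k1, k2, k3, k4, k5⟩ := hF.swap.exists_tip hfin' (x := y) (y := x)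
    (c := (y + 1, x)) hd hc (Or.inr rfl)
  have k1' : Relation.ReflTransGen (LayerStep F) (p, q) (x, y) :=
    Relation.reflTransGen_swap.1
      (Relation.ReflTransGen.lift (p := Function.swap (LayerStep F)) Prod.swap
        (fun a b hab => layerStep_swap hab) _ _ k1)
  obtain ⟨n, δ, -, hδ0, hδn, hδ⟩ := exists_layerPath_extend (F := F) (δ := fun _ => (p, q)) (n := 0)
    (by simp) k1'
  obtain ⟨L, δ', hnL, hδ0', hδL, hδ'⟩ := exists_layerPath_extend hδ (b := (u, v)) (by rwa [hδn])
  have e0 : δ' 0 = (p, q) := by rw [hδ0' 0 (Nat.zero_le _), hδ0 0 le_rfl]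
  have en : δ' n = (x, y) := by rw [hδ0' n le_rfl, hδn]
  have hpP : (p + 1, q) ∈ P := hF.mem_of_right k2 k3
  have hlay : ∀ i ≤ L, δ' i ∈ layer F := by
    intro i hi
    rcases Nat.lt_or_ge i L with hi' | hi'
    · exact (hδ' i hi').2.1
    · obtain rfl : i = L := le_antisymm hi hi'
      rw [hδL]
      exact ⟨h2, hF.right h3 (hF.mem_of_up h2 h3)⟩
  obtain ⟨U, hU1, hU2, hU3, hU4⟩ := hF.exists_trap_of_path hδ' hlay (by simpa [hδL] using h3)
    (by simpa [hδL] using h4) (by simpa [e0] using k3) (by simpa [e0] using k4)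
  refine ⟨U, hU1, hU2, en ▸ hU3 n hnL, (q, p + 1), hpP, k5, fun w hw => ?_⟩
  have := hU4 w hw
  rw [e0] at this
  simp at this ⊢
  omega

theorem ForwardClosed.exists_mem_diagonal {P F : Set Site} (hF : ForwardClosed P F)
    (hne : F.Nonempty) (t : ℤ) : ∃ c ∈ F, c.2 - c.1 = t := by
  obtain ⟨a, ha⟩ := hne
  rcases le_total (a.2 - a.1) t with h | h
  · obtain ⟨γ, h0, hγ⟩ := hF.exists_upper_staircase ha
    have key : ∀ n : ℕ, (γ n).2 - (γ n).1 = a.2 - a.1 + n := by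
      intro n
      induction n with
      | zero => simp [h0]
      | succ n ih => rcases (hγ n).2 with h | h <;> simp [h.2] <;> omega
    refine ⟨γ (t - (a.2 - a.1)).toNat, (hγ _).1, ?_⟩
    rw [key]; omega
  · obtain ⟨γ, h0, hγ⟩ := hF.exists_lower_staircase ha
    have key : ∀ n : ℕ, (γ n).2 - (γ n).1 = a.2 - a.1 - n := by
      intro n
      induction n with
      | zero => simp [h0]
      | succ n ih => rcases (hγ n).2 with h | h <;> simp [h.2] <;> omega
    refine ⟨γ ((a.2 - a.1) - t).toNat, (hγ _).1, ?_⟩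
    rw [key]; omega

/-- A vertical ray starting below a forward closed set enters it. -/
theorem ForwardClosed.exists_mem_above {P F : Set Site} (hF : ForwardClosed P F)
    (hfin : TriFinite P) {x y : ℤ} {c : Site} (hc : c ∈ F) (ht : c.2 - c.1 = y - x)
    (hh : x + y < c.1 + c.2) : ∃ k : ℕ, (x, y + k) ∈ F := by
  by_contra! hno
  obtain ⟨γ, h0, hγ⟩ := hF.exists_upper_staircase hc
  have hstep : ∀ n, ((γ n ∈ P ∧ (γ (n + 1)).1 = (γ n).1 ∧ (γ (n + 1)).2 = (γ n).2 + 1) ∨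
      ((γ (n + 1)).1 = (γ n).1 - 1 ∧ (γ (n + 1)).2 = (γ n).2)) := by
    intro n
    rcases (hγ n).2 with h | h <;> simp [h]
  -- Staircase and ray reach each diagonal at the same index. If they never meet, the staircase
  -- stays strictly to the right of the ray.
  have key : ∀ n : ℕ, (γ n).2 - (γ n).1 = y - x + n ∧ x < (γ n).1 := by
    intro n
    induction n with
    | zero => simp [h0]; omega
    | succ n ih =>
      have h1 : ¬((γ (n + 1)).1 = x ∧ (γ (n + 1)).2 = y + (n + 1 : ℕ)) := fun h =>
        hno (n + 1) (by rw [← h.1, ← h.2]; exact (hγ (n + 1)).1)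
      have := hstep n
      push_cast at *
      omega
  -- The first coordinate is nonincreasing and bounded below, hence eventually constant. From then
  -- on every step goes up from a site of P, giving an infinite triangular cluster.
  obtain ⟨n₀, hn₀⟩ : ∃ n₀, ∀ n, (γ n₀).1 ≤ (γ n).1 := by
    obtain ⟨_, ⟨n₀, rfl⟩, hmin⟩ := WellFounded.has_min wellFounded_lt
      (Set.range fun n => ((γ n).1 - x).toNat) ⟨_, 0, rfl⟩
    refine ⟨n₀, fun n => ?_⟩
    have := hmin _ ⟨n, rfl⟩
    have h1 := (key n).2
    have h2 := (key n₀).2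
    simp only at this
    omega
  have hconst : ∀ m : ℕ, (γ (n₀ + m)).1 = (γ n₀).1 := by
    intro m
    induction m with
    | zero => rfl
    | succ m ih =>
      have := hstep (n₀ + m)
      have := hn₀ (n₀ + m + 1)
      rw [← add_assoc]
      omega
  have hup : ∀ m : ℕ, γ (n₀ + m) ∈ P ∧ (γ (n₀ + m + 1)).1 = (γ (n₀ + m)).1 ∧
      (γ (n₀ + m + 1)).2 = (γ (n₀ + m)).2 + 1 := by
    intro m
    rcases hstep (n₀ + m) with h | h
    · exact h
    · have := hconst m
      have := hconst (m + 1)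
      rw [← add_assoc] at this
      omega
  have hconn : ∀ m : ℕ, TriConnects P (γ n₀) (γ (n₀ + m)) := by
    intro m
    induction m with
    | zero => exact .refl
    | succ m ih =>
      refine ih.tail ⟨(hup m).1, ?_⟩
      have : γ (n₀ + (m + 1)) - γ (n₀ + m) = (0, 1) := by
        have := hup m
        rw [← add_assoc]
        ext <;> simp [this]
      simp [this, stepsTriangular]
  refine Set.infinite_of_injective_forall_mem (f := fun m => γ (n₀ + m)) ?_ hconn (hfin (γ n₀))
  intro m m' h
  simp only at h
  have h1 := (key (n₀ + m)).1
  have h2 := (key (n₀ + m')).1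
  rw [h] at h1
  push_cast at h1 h2
  omega

/-- The site just before the first entry of the vertical ray into F is trapped, and the trap extends
down the ray, which avoids F up to there. The entry height k + 1 and the chain end z serve the
uniform bound on k. -/
theorem ForwardClosed.exists_trap_of_below {P F : Set Site} (hF : ForwardClosed P F)
    (hfin : TriFinite P) (hfin' : TriFinite (Prod.swap ⁻¹' P)) {x y : ℤ} (ho : (x, y) ∉ F)
    {c : Site} (hc : c ∈ F) (ht : c.2 - c.1 = y - x) (hh : x + y < c.1 + c.2) :
    ∃ k : ℕ, (x, y + (k + 1 : ℕ)) ∈ F ∧ ∃ U : Set Site, U.Finite ∧ Traps F U ∧ (x, y) ∈ U ∧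
      ∃ z ∈ Prod.swap ⁻¹' P, TriConnects (Prod.swap ⁻¹' P) (y + (k + 1 : ℕ), x) z ∧
        ∀ v ∈ U, z.1 - z.2 < v.2 - v.1 := by
  classical
  have hex := hF.exists_mem_above hfin hc ht hh
  obtain ⟨k, hk⟩ : ∃ k, Nat.find hex = k + 1 := by
    refine Nat.exists_eq_succ_of_ne_zero fun h => ho ?_
    simpa [h] using Nat.find_spec hex
  have hkF : (x, y + (k + 1 : ℕ)) ∈ F := hk ▸ Nat.find_spec hex
  have hno : ∀ i ≤ k, (x, y + (i : ℕ)) ∉ F := fun i hi => Nat.find_min hex (by omega)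
  obtain ⟨U, h1, h2, h3, z, h4, h5, h6⟩ := hF.exists_trap_below hfin hfin' (hno k le_rfl)
    (by simpa [add_assoc] using hkF)
  refine ⟨k, hkF, U, h1, h2, ?_, z, h4, by simpa [add_assoc] using h5, h6⟩
  have hseg : ∀ i ≤ k, (x, y + ((k - i : ℕ) : ℤ)) ∈ U := by
    intro i
    induction i with
    | zero => simpa using h3
    | succ i ih =>
      intro hi
      refine h2 _ (ih (by omega)) _ ?_ (hno _ (by omega))
      have : ((k - i : ℕ) : ℤ) = ((k - (i + 1) : ℕ) : ℤ) + 1 := by omega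
      simp [latticeGraph, this]
  simpa using hseg k le_rfl

/-! ### Complements of forward closed sets and a uniform hitting bound -/

/-- All boundary chains of forward closed sets, in either direction and of either type, are
finite. -/
structure AllTriFinite (P : Set Site) : Prop where
  pos : TriFinite P
  pos_swap : TriFinite (Prod.swap ⁻¹' P)
  neg : TriFinite {v | -v ∉ P}
  neg_swap : TriFinite (Prod.swap ⁻¹' {v | -v ∉ P})

theorem Traps.neg {F U : Set Site} (h : Traps {v | -v ∈ F} U) : Traps F {v | -v ∈ U} := by
  intro v hv u huv huF
  refine h (-v) hv (-u) ?_ (by simpa using huF)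
  have h' : |u.1 - v.1| + |u.2 - v.2| = 1 := huv
  change |(-u).1 - (-v).1| + |(-u).2 - (-v).2| = 1
  rw [← h', ← abs_neg (u.1 - v.1), ← abs_neg (u.2 - v.2)]
  congr 2 <;> simp <;> ring

theorem ForwardClosed.exists_trap {P F : Set Site} (hF : ForwardClosed P F) (hP : AllTriFinite P)
    (hne : F.Nonempty) {o : Site} (ho : o ∉ F) :
    ∃ U : Set Site, U.Finite ∧ Traps F U ∧ o ∈ U := by
  obtain ⟨x, y⟩ := o
  obtain ⟨c, hc, ht⟩ := hF.exists_mem_diagonal hne (y - x)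
  rcases lt_trichotomy (x + y) (c.1 + c.2) with hh | hh | hh
  · obtain ⟨_, _, U, h1, h2, h3, -⟩ := hF.exists_trap_of_below hP.pos hP.pos_swap ho hc ht hh
    exact ⟨U, h1, h2, h3⟩
  · have : c = (x, y) := Prod.ext (by simp; omega) (by simp; omega)
    exact absurd (this ▸ hc) ho
  · obtain ⟨_, _, U, h1, h2, h3, -⟩ := hF.neg.exists_trap_of_below hP.neg hP.neg_swap
      (x := -x) (y := -y) (c := -c) (by simpa using ho) (by simpa using hc)
      (by simp; omega) (by simp; omega)
    exact ⟨{v | -v ∈ U}, h1.preimage neg_injective.injOn, h2.neg, h3⟩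

/-- Clusters started far out on the horizontal axis do not reach the diagonal. -/
def AxisBounded (P : Set Site) : Prop :=
  ∃ n₀ : ℕ, ∀ k : ℕ, n₀ < k → ∀ z ∈ P, TriConnects P (k, 0) z → 0 ≤ z.1 - z.2

theorem exists_axis_hitting_bound {P : Set Site} (hP : AllTriFinite P)
    (h1 : AxisBounded (Prod.swap ⁻¹' P)) (h2 : AxisBounded (Prod.swap ⁻¹' {v | -v ∉ P})) :
    ∃ N : ℕ, ∀ F : Set Site, ForwardClosed P F → F.Nonempty →
      ∃ k ∈ Set.Icc (-N : ℤ) N, ((0, k) : Site) ∈ F := by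
  obtain ⟨n₁, hn₁⟩ := h1
  obtain ⟨n₂, hn₂⟩ := h2
  refine ⟨n₁ + n₂, fun F hF hne => ?_⟩
  by_cases ho : ((0, 0) : Site) ∈ F
  · exact ⟨0, by simp; omega, ho⟩
  obtain ⟨c, hc, ht⟩ := hF.exists_mem_diagonal hne (0 - 0)
  rcases lt_trichotomy (0 + 0) (c.1 + c.2) with hh | hh | hh
  · obtain ⟨k, hk, U, -, -, h3, z, h4, h5, h6⟩ :=
      hF.exists_trap_of_below hP.pos hP.pos_swap ho hc ht hh
    refine ⟨(k + 1 : ℕ), ?_, by simpa using hk⟩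
    -- If the entry height exceeded n₁, the chain from it would end at z.1 - z.2 ≥ 0. But the trap
    -- contains the origin, which forces z.1 - z.2 < 0.
    by_contra hcon
    have := hn₁ (k + 1) (by simp at hcon; omega) z h4 (by simpa using h5)
    have := h6 _ h3
    simp at this
    omega
  · have : c = (0, 0) := Prod.ext (by simp; omega) (by simp; omega)
    exact absurd (this ▸ hc) ho
  · obtain ⟨k, hk, U, -, -, h3, z, h4, h5, h6⟩ :=
      hF.neg.exists_trap_of_below hP.neg hP.neg_swap (x := 0) (y := 0) (c := -c)
        (by simpa using ho) (by simpa using hc) (by simp; omega) (by simp; omega)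
    refine ⟨-(k + 1 : ℕ), ?_, by simpa using hk⟩
    by_contra hcon
    have := hn₂ (k + 1) (by simp at hcon; omega) z h4 (by simpa using h5)
    have := h6 _ h3
    simp at this
    omega

/-! ### From finite boundary chains to a gigantic component -/

theorem forwardClosed_of_connects {G : Env} (hG : ∀ v, G v = stepsNE ∨ G v = stepsSW) {F : Set Site}
    (hF : ∀ v ∈ F, ∀ u, u - v ∈ G v → u ∈ F) : ForwardClosed {v | G v = stepsNE} F where
  right h hP := hF _ h _ (by rw [show G _ = stepsNE from hP]; simp [stepsNE])
  up h hP := hF _ h _ (by rw [show G _ = stepsNE from hP]; simp [stepsNE])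
  left h hP := hF _ h _ (by rw [(hG _).resolve_left hP]; simp [stepsSW])
  down h hP := hF _ h _ (by rw [(hG _).resolve_left hP]; simp [stepsSW])

theorem latticeGraph_adj_of_sub_mem {G : Env} (hG : ∀ v, G v = stepsNE ∨ G v = stepsSW)
    {v u : Site} (h : u - v ∈ G v) : latticeGraph.Adj u v := by
  change |v.1 - u.1| + |v.2 - u.2| = 1
  rw [abs_sub_comm v.1, abs_sub_comm v.2, ← Prod.fst_sub, ← Prod.snd_sub]
  generalize u - v = d at h
  rcases hG v with hv | hv <;> rw [hv] at h <;>
    simp only [stepsNE, stepsSW, Set.mem_insert_iff, Set.mem_singleton_iff] at h <;>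
    rcases h with rfl | rfl <;> simp

theorem hasGiganticComponent_of_boundary_chains {G : Env}
    (hG : ∀ v, G v = stepsNE ∨ G v = stepsSW) (hP : AllTriFinite {v | G v = stepsNE})
    (h1 : AxisBounded (Prod.swap ⁻¹' {v | G v = stepsNE}))
    (h2 : AxisBounded (Prod.swap ⁻¹' {v | -v ∉ {v | G v = stepsNE}})) :
    HasGiganticComponent G := by
  have hfwd : ∀ x, ForwardClosed {v | G v = stepsNE} (forwardCluster G x) := fun x =>
    forwardClosed_of_connects hG fun v hv u hu => Relation.ReflTransGen.tail hv hu
  have hback : ∀ x, ForwardClosed {v | G v = stepsNE} {v | ¬Connects G v x} := fun x =>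
    forwardClosed_of_connects hG fun v hv u hu hux => hv (Relation.ReflTransGen.head hu hux)
  obtain ⟨N, hN⟩ := exists_axis_hitting_bound hP h1 h2
  -- Pigeonhole: each of the infinitely many sites reaches one of the finitely many (0, k) with |k|
  -- ≤ N.
  obtain ⟨x, hx⟩ : ∃ x, {v | Connects G v x}.Infinite := by
    by_contra! hcon
    have hfin : (⋃ k ∈ Set.Icc (-N : ℤ) N, {v | Connects G v (0, k)}).Finite :=
      (Set.finite_Icc _ _).biUnion fun k _ => hcon (0, k)
    refine Set.infinite_univ (hfin.subset fun v _ => ?_)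
    obtain ⟨k, hk, hvk⟩ := hN _ (hfwd v) ⟨v, .refl⟩
    exact Set.mem_biUnion hk hvk
  have hall : ∀ v, Connects G v x := by
    by_contra! hcon
    obtain ⟨U, hU1, hU2, hU3⟩ := (hback x).exists_trap hP hcon (o := x) (fun h => h .refl)
    -- A path into x, read backwards, stays among sites that reach x. It therefore avoids the
    -- forward closed set and never leaves U.
    refine hx (hU1.subset fun v hv => ?_)
    induction (show Connects G v x from hv) using Relation.ReflTransGen.head_induction_on with
    | refl => exact hU3
    | head hac hcx ih =>
      exact hU2 _ (ih hcx) _ (latticeGraph_adj_of_sub_mem hG hac) (not_not.2 (.head hac hcx))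
  have hM : mutualCluster G x = forwardCluster G x := by
    ext v
    exact ⟨fun h => h.1, fun h => ⟨h, hall v⟩⟩
  refine ⟨x, ?_, fun K => ?_⟩
  · rw [hM]
    choose f hf hft using (hfwd x).exists_mem_diagonal ⟨x, .refl⟩
    refine Set.infinite_of_injective_forall_mem (f := f) (fun a b hab => ?_) hf
    rw [← hft a, ← hft b, hab]
  · induction K using SimpleGraph.ConnectedComponent.ind with
    | h v =>
      obtain ⟨U, hU1, hU2, hU3⟩ := (hfwd x).exists_trap hP ⟨x, .refl⟩ (o := v)
        (hM ▸ v.2)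
      refine (hU1.preimage Subtype.val_injective.injOn).subset fun u hu => ?_
      have hreach : (latticeGraph.induce (mutualCluster G x)ᶜ).Reachable v u :=
        (SimpleGraph.ConnectedComponent.exact hu).symm
      rw [SimpleGraph.reachable_iff_reflTransGen] at hreach
      induction hreach with
      | refl => exact hU3
      | @tail b c hb hbc ih =>
        refine hU2 _ (ih ?_) _ hbc (hM ▸ c.2)
        exact SimpleGraph.ConnectedComponent.sound
          ((SimpleGraph.reachable_iff_reflTransGen _ _).2 hb).symm

/-! ### Column exploration of triangular paths -/

theorem TriConnects.map {P P' : Set Site} {a b : Site} (h : TriConnects P a b) (f : Site → Site)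
    (hP : ∀ v ∈ P, f v ∈ P')
    (hf : ∀ v u, u - v ∈ stepsTriangular → f u - f v ∈ stepsTriangular) :
    TriConnects P' (f a) (f b) := by
  induction h with
  | refl => exact .refl
  | tail _ hbc ih => exact ih.tail ⟨hP _ hbc.1, hf _ _ hbc.2⟩

theorem step_cases {a b : Site} (h : b - a ∈ stepsTriangular) :
    a = (b.1 + 1, b.2) ∨ a = (b.1, b.2 - 1) ∨ a = (b.1 + 1, b.2 - 1) := by
  simp only [stepsTriangular, Set.mem_insert_iff, Set.mem_singleton_iff, Prod.ext_iff,
    Prod.fst_sub, Prod.snd_sub] at h ⊢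
  omega

theorem TriConnects.exists_displacement {P : Set Site} {a b : Site} (h : TriConnects P a b) :
    ∃ i j : ℕ, b = (a.1 - i, a.2 + j) := by
  induction h with
  | refl => exact ⟨0, 0, by simp⟩
  | tail _ hbc ih =>
    obtain ⟨i, j, rfl⟩ := ih
    rcases step_cases hbc.2 with h | h | h <;> simp only [Prod.ext_iff] at h
    · exact ⟨i + 1, j, by ext <;> simp <;> omega⟩
    · exact ⟨i, j + 1, by ext <;> simp <;> omega⟩
    · exact ⟨i + 1, j + 1, by ext <;> simp <;> omega⟩

/-- Some site of `P` in the column `-n`, at height at least `m`, is reached from the origin. -/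
def ReachesAbove (P : Set Site) (n : ℕ) (m : ℤ) : Prop :=
  ∃ y ≥ m, TriConnects P 0 (-n, y) ∧ ((-n, y) : Site) ∈ P

theorem ReachesAbove.mono {P : Set Site} {n : ℕ} {m m' : ℤ} (h : ReachesAbove P n m)
    (hm : m' ≤ m) : ReachesAbove P n m' := by
  obtain ⟨y, hy, h⟩ := h
  exact ⟨y, hm.trans hy, h⟩

theorem TriConnects.of_fst_eq_zero {P : Set Site} {z : Site} (h : TriConnects P 0 z) :
    z.1 = 0 → ∀ i, 0 ≤ i → i < z.2 → ((0, i) : Site) ∈ P := by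
  induction h with
  | refl => intro _ i h1 h2; simp at h2; omega
  | @tail b c hb hbc ih =>
    intro hc i h1 h2
    obtain ⟨k, _, hk⟩ := TriConnects.exists_displacement hb
    have hk1 : b.1 = -k := by simp [hk]
    rcases step_cases hbc.2 with h | h | h
    · simp [h, hc] at hk1; omega
    · have hb1 : b.1 = 0 := by simp [h, hc]
      have hb2 : b.2 = c.2 - 1 := by simp [h]
      rcases (by omega : i < b.2 ∨ i = b.2) with h3 | h3
      · exact ih hb1 i h1 h3
      · rw [h3, ← hb1]; exact hbc.1
    · simp [h, hc] at hk1; omega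

/-- A path reaching the column `-(n + 1)` climbs there from a site entered from column `-n`. -/
theorem TriConnects.exists_column_entry {P : Set Site} {n : ℕ} {z : Site}
    (h : TriConnects P 0 z) : z.1 = -(n + 1 : ℕ) →
      ∃ y ≤ z.2, (∀ i, y ≤ i → i < z.2 → ((z.1, i) : Site) ∈ P) ∧ ReachesAbove P n (y - 1) := by
  induction h with
  | refl => intro h; simp at h; omega
  | @tail b c hb hbc ih =>
    intro hc
    rcases step_cases hbc.2 with h | h | h
    · have hb' : b = ((-n : ℤ), c.2) := by rw [h, hc]; simp
      exact ⟨c.2, le_rfl, fun i _ _ => by omega, c.2, by simp, hb' ▸ hb, hb' ▸ hbc.1⟩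
    · have hb1 : b.1 = c.1 := by simp [h]
      have hb2 : b.2 = c.2 - 1 := by simp [h]
      obtain ⟨y, h1, h2, h3⟩ := ih (hb1.trans hc)
      refine ⟨y, by omega, fun i h4 h5 => ?_, h3⟩
      rcases (by omega : i < b.2 ∨ i = b.2) with h6 | h6
      · exact hb1 ▸ h2 i h4 h6
      · rw [h6, ← hb1]; exact hbc.1
    · have hb' : b = ((-n : ℤ), c.2 - 1) := by rw [h, hc]; simp
      exact ⟨c.2, le_rfl, fun i _ _ => by omega, c.2 - 1, by simp, hb' ▸ hb, hb' ▸ hbc.1⟩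

/-- One step of the column exploration. -/
theorem ReachesAbove.step {P : Set Site} {n : ℕ} {m : ℤ} (h : ReachesAbove P (n + 1) m) (J : ℕ) :
    (∃ j < J, ReachesAbove P n (m - (j + 1 : ℕ)) ∧
      (∀ i < j + 1, ((-(n + 1 : ℕ), m - (i : ℕ)) : Site) ∈ P) ∧
        ((-(n + 1 : ℕ), m - (j + 1 : ℕ)) : Site) ∉ P) ∨
    (∀ i < J + 1, ((-(n + 1 : ℕ), m - (i : ℕ)) : Site) ∈ P) ∨
    (ReachesAbove P n m ∧ ((-(n + 1 : ℕ), m + 1) : Site) ∈ P ∧ ((-(n + 1 : ℕ), m) : Site) ∉ P) ∨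
    (ReachesAbove P n (m + 1) ∧ ((-(n + 1 : ℕ), m + 2) : Site) ∈ P ∧
      ((-(n + 1 : ℕ), m) : Site) ∉ P ∧ ((-(n + 1 : ℕ), m + 1) : Site) ∉ P) ∨
    (ReachesAbove P n (m + 2) ∧ ((-(n + 1 : ℕ), m) : Site) ∉ P ∧
      ((-(n + 1 : ℕ), m + 1) : Site) ∉ P ∧ ((-(n + 1 : ℕ), m + 2) : Site) ∉ P) := by
  obtain ⟨y, hy, hc, hyP⟩ := h
  obtain ⟨y', h1, h2, h3⟩ := hc.exists_column_entry rfl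
  have hall : ∀ i, y' ≤ i → i ≤ y → ((-(n + 1 : ℕ), i) : Site) ∈ P := by
    intro i h4 h5
    rcases h5.lt_or_eq with h5 | rfl
    · exact h2 i h4 h5
    · exact hyP
  -- The path climbs its last column through P from y' to y, so a closed site at height i ≤ y forces
  -- the entry above i. The previous column was then reached at height at least i.
  have hlt : ∀ i ≤ y, ((-(n + 1 : ℕ), i) : Site) ∉ P → i < y' := fun i hi hiP => by
    by_contra hcon
    exact hiP (hall i (not_lt.1 hcon) hi)
  have hy' : ∀ i ≤ y, ((-(n + 1 : ℕ), i) : Site) ∉ P → i < y := fun i hi hiP =>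
    (hlt i hi hiP).trans_le h1
  by_cases hm : ((-(n + 1 : ℕ), m) : Site) ∈ P
  · by_cases hrun : ∀ i < J + 1, ((-(n + 1 : ℕ), m - (i : ℕ)) : Site) ∈ P
    · exact Or.inr (Or.inl hrun)
    · left
      push Not at hrun
      classical
      obtain ⟨hJ, hj⟩ := Nat.find_spec hrun
      have hmin := fun i hi => Nat.find_min hrun (m := i) hi
      obtain ⟨j, hjeq⟩ : ∃ j, Nat.find hrun = j + 1 := by
        refine Nat.exists_eq_succ_of_ne_zero fun h => ?_
        rw [h] at hj
        simp only [Nat.cast_zero, sub_zero] at hj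
        exact hj hm
      rw [hjeq] at hJ hj hmin
      refine ⟨j, by omega, h3.mono ?_, fun i hi => ?_, hj⟩
      · have := hlt _ (by push_cast; omega) hj
        omega
      · by_contra hcon
        exact hmin i hi ⟨by omega, hcon⟩
  · have l1 := hlt m hy hm
    by_cases hm1 : ((-(n + 1 : ℕ), m + 1) : Site) ∈ P
    · exact Or.inr (Or.inr (Or.inl ⟨h3.mono (by omega), hm1, hm⟩))
    have l2 := hlt (m + 1) (by have := hy' m hy hm; omega) hm1
    by_cases hm2 : ((-(n + 1 : ℕ), m + 2) : Site) ∈ P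
    · exact Or.inr (Or.inr (Or.inr (Or.inl ⟨h3.mono (by omega), hm2, hm, hm1⟩)))
    have l3 := hlt (m + 2) (by omega) hm2
    exact Or.inr (Or.inr (Or.inr (Or.inr ⟨h3.mono (by omega), hm, hm1, hm2⟩)))

/-! ### Site events and independence -/

section Probability

variable {Ω : Type*} {O : Site → Set Ω}

/-- The event that all sites of `a` are open and all sites of `b` are closed. -/
def cellEvent (O : Site → Set Ω) (a b : Finset Site) : Set Ω :=
  {ω | (∀ v ∈ a, ω ∈ O v) ∧ ∀ v ∈ b, ω ∉ O v}

/-- The events determined by the states of the sites in `S`. -/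
abbrev siteSigma (O : Site → Set Ω) (S : Set Site) : MeasurableSpace Ω :=
  ⨆ v ∈ S, MeasurableSpace.generateFrom {O v}

theorem measurableSet_siteSigma {S : Set Site} {v : Site} (hv : v ∈ S) :
    MeasurableSet[siteSigma O S] (O v) :=
  le_iSup₂_of_le (f := fun v (_ : v ∈ S) => MeasurableSpace.generateFrom {O v}) v hv le_rfl _
    (MeasurableSpace.measurableSet_generateFrom rfl)

theorem measurableSet_cellEvent {S : Set Site} {a b : Finset Site} (ha : ∀ v ∈ a, v ∈ S)
    (hb : ∀ v ∈ b, v ∈ S) : MeasurableSet[siteSigma O S] (cellEvent O a b) := by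
  have : cellEvent O a b = (⋂ v ∈ a, O v) ∩ ⋂ v ∈ b, (O v)ᶜ := by
    ext ω; simp [cellEvent]
  rw [this]
  refine MeasurableSet.inter (m := siteSigma O S) ?_ ?_
  · exact Finset.measurableSet_biInter (m := siteSigma O S) _
      fun v hv => measurableSet_siteSigma (ha v hv)
  · exact Finset.measurableSet_biInter (m := siteSigma O S) _
      fun v hv => (measurableSet_siteSigma (hb v hv)).compl

/-- The event that `z` is reached from the origin in exactly `k` steps. -/
def reachEvent (O : Site → Set Ω) : ℕ → Site → Set Ω
  | 0, z => {_ω | z = 0}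
  | k + 1, z => (reachEvent O k (z.1 + 1, z.2) ∩ O (z.1 + 1, z.2)) ∪
      (reachEvent O k (z.1, z.2 - 1) ∩ O (z.1, z.2 - 1)) ∪
      (reachEvent O k (z.1 + 1, z.2 - 1) ∩ O (z.1 + 1, z.2 - 1))

theorem setOf_triConnects_eq (O : Site → Set Ω) (z : Site) :
    {ω | TriConnects {v | ω ∈ O v} 0 z} = ⋃ k, reachEvent O k z := by
  ext ω
  simp only [Set.mem_iUnion]
  constructor
  · intro h
    induction (show TriConnects {v | ω ∈ O v} 0 z from h) with
    | refl => exact ⟨0, rfl⟩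
    | @tail b c hb hbc ih =>
      obtain ⟨k, hk⟩ := ih hb
      refine ⟨k + 1, ?_⟩
      have hbO : ω ∈ O b := hbc.1
      rcases step_cases hbc.2 with h | h | h <;> subst h
      · exact Or.inl (Or.inl ⟨hk, hbO⟩)
      · exact Or.inl (Or.inr ⟨hk, hbO⟩)
      · exact Or.inr ⟨hk, hbO⟩
  · rintro ⟨k, hk⟩
    show TriConnects {v | ω ∈ O v} 0 z
    induction k generalizing z with
    | zero => rw [show z = 0 from hk]; exact .refl
    | succ k ih =>
      rcases hk with (⟨h1, h2⟩ | ⟨h1, h2⟩) | ⟨h1, h2⟩ <;>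
        exact (ih _ h1).tail ⟨h2, by simp [stepsTriangular, Prod.ext_iff]⟩

theorem measurableSet_reachEvent {x : ℤ} (k : ℕ) : ∀ z : Site, x ≤ z.1 →
    MeasurableSet[siteSigma O {v | x ≤ v.1}] (reachEvent O k z) := by
  induction k with
  | zero => intro z _; exact MeasurableSet.const _
  | succ k ih =>
    intro z hz
    have key : ∀ w : Site, x ≤ w.1 →
        MeasurableSet[siteSigma O {v | x ≤ v.1}] (reachEvent O k w ∩ O w) := fun w hw =>
      MeasurableSet.inter (ih w hw) (measurableSet_siteSigma (S := {v | x ≤ v.1}) hw)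
    exact ((key _ (by simp; omega)).union (key _ (by simp; omega))).union (key _ (by simp; omega))

/-- Steps never go right, so reaching column -n involves only columns weakly to its right. This
makes the event independent of the next column. -/
theorem measurableSet_reachesAbove (O : Site → Set Ω) (n : ℕ) (m : ℤ) :
    MeasurableSet[siteSigma O {v | (-n : ℤ) ≤ v.1}] {ω | ReachesAbove {v | ω ∈ O v} n m} := by
  have : {ω | ReachesAbove {v | ω ∈ O v} n m} =
      ⋃ y ∈ Set.Ici m, ({ω | TriConnects {v | ω ∈ O v} 0 (-n, y)} ∩ O (-n, y)) := by
    ext ω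
    simp [ReachesAbove, and_left_comm]
  rw [this]
  refine MeasurableSet.biUnion (m := siteSigma O {v | (-n : ℤ) ≤ v.1}) (Set.to_countable _)
    fun y _ => MeasurableSet.inter ?_
      (measurableSet_siteSigma (S := {v | (-n : ℤ) ≤ v.1}) (v := (-n, y))
        (le_refl (-n : ℤ)))
  rw [setOf_triConnects_eq]
  exact MeasurableSet.iUnion fun k => measurableSet_reachEvent k (-n, y) le_rfl

variable [MeasurableSpace Ω] {μ : Measure Ω} [IsProbabilityMeasure μ] {p : ℝ}

theorem measureReal_cellEvent (hO : ∀ v, MeasurableSet (O v)) (hind : iIndepSet O μ)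
    (hp : ∀ v, μ.real (O v) = p) {a b : Finset Site} (hab : Disjoint a b) :
    μ.real (cellEvent O a b) = p ^ a.card * (1 - p) ^ b.card := by
  classical
  have h1 : cellEvent O a b = ⋂ v ∈ a ∪ b, if v ∈ a then O v else (O v)ᶜ := by
    ext ω
    simp only [cellEvent, Set.mem_iInter, Finset.mem_union]
    constructor
    · rintro ⟨h1, h2⟩ v hv
      by_cases hva : v ∈ a
      · simpa [hva] using h1 v hva
      · simpa [hva] using h2 v (hv.resolve_left hva)
    · intro h
      refine ⟨fun v hv => by simpa [hv] using h v (Or.inl hv), fun v hv => ?_⟩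
      have hva : v ∉ a := fun hva => Finset.disjoint_left.1 hab hva hv
      simpa [hva] using h v (Or.inr hv)
  have h2 : μ (⋂ v ∈ a ∪ b, if v ∈ a then O v else (O v)ᶜ) =
      ∏ v ∈ a ∪ b, μ (if v ∈ a then O v else (O v)ᶜ) := by
    refine iIndep.meas_biInter (m := fun v => MeasurableSpace.generateFrom {O v}) hind ?_
    intro v _
    have : MeasurableSet[MeasurableSpace.generateFrom {O v}] (O v) :=
      MeasurableSpace.measurableSet_generateFrom rfl
    split_ifs
    · exact this
    · exact this.compl
  rw [h1, measureReal_def, h2, ENNReal.toReal_prod, Finset.prod_union hab]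
  congr 1
  · rw [Finset.prod_congr rfl fun v hv => by rw [if_pos hv, ← measureReal_def, hp v]]
    simp
  · rw [Finset.prod_congr rfl fun v hv => by
      rw [if_neg (Finset.disjoint_right.1 hab hv), ← measureReal_def,
        measureReal_compl (hO v), hp v]]
    simp

theorem measureReal_inter_cellEvent (hO : ∀ v, MeasurableSet (O v)) (hind : iIndepSet O μ)
    (hp : ∀ v, μ.real (O v) = p) {S : Set Site} {E : Set Ω} (hE : MeasurableSet[siteSigma O S] E)
    {a b : Finset Site} (hab : Disjoint a b) (ha : ∀ v ∈ a, v ∉ S) (hb : ∀ v ∈ b, v ∉ S) :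
    μ.real (E ∩ cellEvent O a b) = μ.real E * (p ^ a.card * (1 - p) ^ b.card) := by
  have hi : Indep (siteSigma O S) (siteSigma O Sᶜ) μ :=
    indep_iSup_of_disjoint (fun v => MeasurableSpace.generateFrom_le (by simpa using hO v)) hind
      disjoint_compl_right
  have := (Indep_iff _ _ _).1 hi E (cellEvent O a b) hE (measurableSet_cellEvent ha hb)
  rw [measureReal_def, this, ENNReal.toReal_mul, ← measureReal_def, ← measureReal_def,
    measureReal_cellEvent hO hind hp hab]

end Probability

/-! ### Exponential decay -/

section Decay

variable {Ω : Type*} [MeasurableSpace Ω] {μ : Measure Ω} [IsProbabilityMeasure μ]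
  {O : Site → Set Ω} {p : ℝ}

/-- Inside column 0 a path can only climb, so reaching height m > 0 forces m sites to be open. The
resulting p ^ m is at most θ ^ (-m) because p θ < 1. -/
theorem measureReal_reachesAbove_zero_le (hO : ∀ v, MeasurableSet (O v)) (hind : iIndepSet O μ)
    (hp : ∀ v, μ.real (O v) = p) {θ : ℝ} (hp0 : 0 ≤ p) (hθ : 1 ≤ θ) (hpθ : p * θ < 1) (m : ℤ) :
    μ.real {ω | ReachesAbove {v | ω ∈ O v} 0 m} ≤ θ ^ (-m) := by
  rcases le_or_gt m 0 with hm | hm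
  · exact measureReal_le_one.trans (one_le_zpow₀ hθ (by omega))
  obtain ⟨k, rfl⟩ : ∃ k : ℕ, m = k := ⟨m.toNat, by omega⟩
  have hsub : {ω | ReachesAbove {v | ω ∈ O v} 0 k} ⊆
      cellEvent O ((Finset.range k).image fun i : ℕ => ((0, (i : ℤ)) : Site)) ∅ := by
    rintro ω ⟨y, hy, h, -⟩
    refine ⟨fun v hv => ?_, by simp⟩
    obtain ⟨i, hi, rfl⟩ := Finset.mem_image.1 hv
    have := Finset.mem_range.1 hi
    exact h.of_fst_eq_zero (by simp) i (by omega) (by simp; omega)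
  have hcard : ((Finset.range k).image fun i : ℕ => ((0, (i : ℤ)) : Site)).card = k := by
    rw [Finset.card_image_of_injective _ fun i j hij => by simpa using hij, Finset.card_range]
  have hθ0 : 0 < θ := by linarith
  calc _ ≤ _ := measureReal_mono hsub
    _ = p ^ k := by
      rw [measureReal_cellEvent hO hind hp (Finset.disjoint_empty_right _), hcard]; simp
    _ ≤ (θ⁻¹) ^ k := by
      gcongr
      rw [← one_div, le_div_iff₀ hθ0]
      exact hpθ.le
    _ = θ ^ (-(k : ℤ)) := by simp

theorem sum_geometric_le {x : ℝ} (h0 : 0 ≤ x) (h1 : x < 1) (J : ℕ) :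
    ∑ j ∈ Finset.range J, x ^ j ≤ (1 - x)⁻¹ :=
  tsum_geometric_of_lt_one h0 h1 ▸
    (summable_geometric_of_lt_one h0 h1).sum_le_tsum _ fun _ _ => pow_nonneg h0 _

/-- One step of the column exploration, with the upward run truncated at `J`. -/
theorem measureReal_reachesAbove_succ_le (hO : ∀ v, MeasurableSet (O v)) (hind : iIndepSet O μ)
    (hp : ∀ v, μ.real (O v) = p) (n : ℕ) (m : ℤ) (J : ℕ) :
    μ.real {ω | ReachesAbove {v | ω ∈ O v} (n + 1) m} ≤
      ∑ j ∈ Finset.range J, μ.real {ω | ReachesAbove {v | ω ∈ O v} n (m - (j + 1 : ℕ))} *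
        (p ^ (j + 1) * (1 - p)) + p ^ (J + 1) +
      μ.real {ω | ReachesAbove {v | ω ∈ O v} n m} * (p * (1 - p)) +
      μ.real {ω | ReachesAbove {v | ω ∈ O v} n (m + 1)} * (p * (1 - p) ^ 2) +
      μ.real {ω | ReachesAbove {v | ω ∈ O v} n (m + 2)} * (1 - p) ^ 3 := by
  classical
  set E : ℤ → Set Ω := fun k => {ω | ReachesAbove {v | ω ∈ O v} n k} with hE
  obtain ⟨c, hc⟩ : ∃ c : ℤ, c = -(n + 1 : ℕ) := ⟨_, rfl⟩
  let A : ℕ → Finset Site := fun j =>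
    (Finset.range (j + 1)).image fun i : ℕ => ((c, m - (i : ℕ)) : Site)
  have hA : ∀ j v, v ∈ A j ↔ ∃ i < j + 1, (c, m - (i : ℕ)) = v := by
    intro j v
    simp [A]
  have hAcard : ∀ j, (A j).card = j + 1 := by
    intro j
    simp only [A]
    rw [Finset.card_image_of_injective _ fun i j hij => by simpa using hij, Finset.card_range]
  have hsub : {ω | ReachesAbove {v | ω ∈ O v} (n + 1) m} ⊆
      (⋃ j ∈ Finset.range J, E (m - (j + 1 : ℕ)) ∩ cellEvent O (A j) {(c, m - (j + 1 : ℕ))}) ∪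
      cellEvent O (A J) ∅ ∪ (E m ∩ cellEvent O {(c, m + 1)} {(c, m)}) ∪
      (E (m + 1) ∩ cellEvent O {(c, m + 2)} {(c, m), (c, m + 1)}) ∪
      (E (m + 2) ∩ cellEvent O ∅ {(c, m), (c, m + 1), (c, m + 2)}) := by
    intro ω hω
    have hstep := ReachesAbove.step hω J
    rw [← hc] at hstep
    rcases hstep with ⟨j, hj, h1, h2, h3⟩ | h | ⟨h1, h2, h3⟩ |
      ⟨h1, h2, h3, h4⟩ | ⟨h1, h2, h3, h4⟩
    · refine Or.inl (Or.inl (Or.inl (Or.inl ?_)))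
      refine Set.mem_biUnion (Finset.mem_coe.2 (Finset.mem_range.2 hj)) ⟨h1, fun v hv => ?_, ?_⟩
      · obtain ⟨i, hi, rfl⟩ := (hA j v).1 hv
        exact h2 i hi
      · intro v hv
        rw [Finset.mem_singleton.1 hv]
        exact h3
    · refine Or.inl (Or.inl (Or.inl (Or.inr ⟨fun v hv => ?_, by simp⟩)))
      obtain ⟨i, hi, rfl⟩ := (hA J v).1 hv
      exact h i hi
    · exact Or.inl (Or.inl (Or.inr ⟨h1, by simp [cellEvent]; exact ⟨h2, h3⟩⟩))
    · exact Or.inl (Or.inr ⟨h1, by simp [cellEvent]; tauto⟩)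
    · exact Or.inr ⟨h1, by simp [cellEvent]; tauto⟩
  have hout : ∀ v : Site, v.1 = c → v ∉ {v : Site | (-n : ℤ) ≤ v.1} := by
    intro v hv hv'
    have : (-n : ℤ) ≤ v.1 := hv'
    push_cast at hc
    omega
  have hmeas : ∀ (k : ℤ) {a b : Finset Site}, Disjoint a b → (∀ v ∈ a, v.1 = c) →
      (∀ v ∈ b, v.1 = c) →
        μ.real (E k ∩ cellEvent O a b) = μ.real (E k) * (p ^ a.card * (1 - p) ^ b.card) :=
    fun k a b hab ha hb => measureReal_inter_cellEvent hO hind hp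
      (measurableSet_reachesAbove O n k) hab (fun v hv => hout v (ha v hv))
      (fun v hv => hout v (hb v hv))
  refine (measureReal_mono hsub).trans ((measureReal_union_le _ _).trans (add_le_add
    ((measureReal_union_le _ _).trans (add_le_add ((measureReal_union_le _ _).trans (add_le_add
      ((measureReal_union_le _ _).trans (add_le_add
        ((measureReal_biUnion_finset_le _ _).trans (Finset.sum_le_sum fun j _ => le_of_eq ?_))
        (le_of_eq ?_))) (le_of_eq ?_))) (le_of_eq ?_))) (le_of_eq ?_)))
  · rw [hmeas _ ?_ ?_ (by simp), hAcard, Finset.card_singleton, pow_one]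
    · rw [Finset.disjoint_singleton_right, hA]
      rintro ⟨i, hi, h⟩
      simp only [Prod.mk.injEq, true_and] at h
      omega
    · intro v hv
      obtain ⟨i, hi, rfl⟩ := (hA j v).1 hv
      rfl
  · rw [measureReal_cellEvent hO hind hp (Finset.disjoint_empty_right _), hAcard]
    simp
  · rw [hmeas _ (by simp) (by simp) (by simp)]
    simp only [Finset.card_singleton, pow_one, hE]
  · rw [hmeas _ (by simp) (by simp) (by simp), Finset.card_pair (by simp)]
    simp only [Finset.card_singleton, pow_one, hE]
  · rw [hmeas _ (by simp) (by simp) (by simp), Finset.card_insert_of_notMem (by simp),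
      Finset.card_pair (by simp)]
    simp only [Finset.card_empty, pow_zero, one_mul, hE]

/-- Inserting the bound for column n into the recursion, a height shift by k costs a factor θ ^ k.
The left side of `hA` is the resulting total, with the downward run summed as a geometric series. -/
theorem measureReal_reachesAbove_le (hO : ∀ v, MeasurableSet (O v)) (hind : iIndepSet O μ)
    (hp : ∀ v, μ.real (O v) = p) {θ r : ℝ} (hp0 : 0 ≤ p) (hp1 : p ≤ 1) (hθ : 1 ≤ θ)
    (hpθ : p * θ < 1) (hr : 0 ≤ r)
    (hA : (1 - p) * (p * θ) * (1 - p * θ)⁻¹ + p * (1 - p) + p * (1 - p) ^ 2 * θ⁻¹ +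
      (1 - p) ^ 3 * (θ ^ 2)⁻¹ ≤ r * θ) (n : ℕ) :
    ∀ m : ℤ, μ.real {ω | ReachesAbove {v | ω ∈ O v} n m} ≤ r ^ n * θ ^ ((n : ℤ) - m) := by
  have hθ0 : 0 < θ := by linarith
  have hq : 0 ≤ 1 - p := by linarith
  induction n with
  | zero => simpa using measureReal_reachesAbove_zero_le hO hind hp hp0 hθ hpθ
  | succ n ih =>
    intro m
    set b : ℝ := r ^ n * θ ^ ((n : ℤ) - m) with hb
    have hb0 : 0 ≤ b := by positivity
    have key : ∀ J : ℕ, μ.real {ω | ReachesAbove {v | ω ∈ O v} (n + 1) m} ≤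
        b * (r * θ) + p ^ (J + 1) := by
      intro J
      have h1 : ∑ j ∈ Finset.range J, μ.real {ω | ReachesAbove {v | ω ∈ O v} n (m - (j + 1 : ℕ))} *
          (p ^ (j + 1) * (1 - p)) ≤ b * ((1 - p) * (p * θ) * (1 - p * θ)⁻¹) := by
        calc _ ≤ ∑ j ∈ Finset.range J, b * ((1 - p) * (p * θ)) * (p * θ) ^ j := by
              refine Finset.sum_le_sum fun j _ => ?_
              have h2 : r ^ n * θ ^ ((n : ℤ) - (m - (j + 1 : ℕ))) = b * θ ^ (j + 1) := by
                rw [hb, mul_assoc, ← zpow_natCast θ (j + 1), ← zpow_add₀ hθ0.ne']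
                congr 2
                ring
              calc _ ≤ b * θ ^ (j + 1) * (p ^ (j + 1) * (1 - p)) := by
                    rw [← h2]
                    exact mul_le_mul_of_nonneg_right (ih _) (by positivity)
                _ = _ := by rw [mul_pow]; ring
          _ = b * ((1 - p) * (p * θ)) * ∑ j ∈ Finset.range J, (p * θ) ^ j := by
              rw [Finset.mul_sum]
          _ ≤ b * ((1 - p) * (p * θ)) * (1 - p * θ)⁻¹ := by
              gcongr
              exact sum_geometric_le (by positivity) hpθ J
          _ = _ := by ring
      have h2 : r ^ n * θ ^ ((n : ℤ) - (m + 1)) = b * θ⁻¹ := by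
        rw [hb, mul_assoc, ← zpow_neg_one, ← zpow_add₀ hθ0.ne']
        congr 2; ring
      have h3 : r ^ n * θ ^ ((n : ℤ) - (m + 2)) = b * (θ ^ 2)⁻¹ := by
        rw [hb, mul_assoc, ← zpow_natCast θ 2, ← zpow_neg, ← zpow_add₀ hθ0.ne']
        congr 2; push_cast; ring
      have h4 := mul_le_mul_of_nonneg_right (ih m) (show 0 ≤ p * (1 - p) by positivity)
      have h5 := mul_le_mul_of_nonneg_right (h2 ▸ ih (m + 1))
        (show 0 ≤ p * (1 - p) ^ 2 by positivity)
      have h6 := mul_le_mul_of_nonneg_right (h3 ▸ ih (m + 2))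
        (show 0 ≤ (1 - p) ^ 3 by positivity)
      have h7 := mul_le_mul_of_nonneg_left hA hb0
      have h8 := measureReal_reachesAbove_succ_le hO hind hp n m J
      linarith
    -- Letting J tend to infinity removes the truncation term.
    have hlim : Filter.Tendsto (fun J : ℕ => b * (r * θ) + p ^ (J + 1)) Filter.atTop
        (nhds (b * (r * θ) + 0)) := by
      refine tendsto_const_nhds.add ?_
      refine (tendsto_pow_atTop_nhds_zero_of_lt_one hp0 ?_).comp (Filter.tendsto_add_atTop_nat 1)
      nlinarith
    have := ge_of_tendsto' hlim key
    rw [add_zero] at this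
    refine this.trans (le_of_eq ?_)
    rw [hb, show ((n + 1 : ℕ) : ℤ) - m = ((n : ℤ) - m) + 1 by push_cast; ring,
      zpow_add₀ hθ0.ne', pow_succ, zpow_one]
    ring

end Decay

/-- The choice θ = 41/40, r = 0.9995. At θ = 1 both sides of `hA` with r = 1 agree, so a θ slightly
above 1 exploits the negative drift. -/
theorem growth_factor_le {p : ℝ} (h0 : 0 ≤ p) (h : p ≤ 0.5467) :
    (1 - p) * (p * (41 / 40)) * (1 - p * (41 / 40))⁻¹ + p * (1 - p) +
      p * (1 - p) ^ 2 * (41 / 40 : ℝ)⁻¹ + (1 - p) ^ 3 * ((41 / 40 : ℝ) ^ 2)⁻¹ ≤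
        0.9995 * (41 / 40) := by
  have hpos : 0 < 1 - p * (41 / 40) := by linarith
  -- This is the claim multiplied by θ² (1 - p θ), a polynomial inequality in s = 0.5467 - p.
  have key : (1 - p) * p * (41 / 40) ^ 3 + (1 - p * (41 / 40)) * ((1 - p) * p * (41 / 40) ^ 2 +
      (1 - p) ^ 2 * p * (41 / 40) + (1 - p) ^ 3) ≤
        (1 - p * (41 / 40)) * (0.9995 * (41 / 40) ^ 3) := by
    obtain ⟨s, rfl⟩ : ∃ s, p = 0.5467 - s := ⟨0.5467 - p, by ring⟩
    have hs : 0 ≤ s := by linarith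
    have hs' : s ≤ 0.5467 := by linarith
    nlinarith [mul_nonneg hs (sub_nonneg.2 hs'), mul_nonneg (mul_nonneg hs hs) (sub_nonneg.2 hs'),
      pow_nonneg hs 3, pow_nonneg hs 4]
  have h1 : (1 - p) * (p * (41 / 40)) * (1 - p * (41 / 40))⁻¹ ≤ 0.9995 * (41 / 40) -
      (p * (1 - p) + p * (1 - p) ^ 2 * (41 / 40 : ℝ)⁻¹ + (1 - p) ^ 3 * ((41 / 40 : ℝ) ^ 2)⁻¹) := by
    rw [← div_eq_mul_inv, div_le_iff₀ hpos]
    linarith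
  linarith

/-! ### Almost sure finiteness of clusters -/

section Clusters

variable {Ω : Type*} [MeasurableSpace Ω] {μ : Measure Ω} [IsProbabilityMeasure μ]
  {O : Site → Set Ω} {p : ℝ}

theorem measureReal_le_of_reachesAbove_map (hO : ∀ v, MeasurableSet (O v)) (hind : iIndepSet O μ)
    (hp : ∀ v, μ.real (O v) = p) (hp0 : 0 ≤ p) (hp1 : p ≤ 0.5467) {c z : Site} (a b : ℕ)
    (f g : Site → Site) (hgf : ∀ v, g (f v) = v) (hg : Function.Injective g)
    (hf : ∀ v u, u - v ∈ stepsTriangular → f u - f v ∈ stepsTriangular) (hc : f c = 0)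
    (hz : f z = ((-a : ℤ), (b : ℤ))) :
    μ.real {ω | TriConnects {v | ω ∈ O v} c z ∧ ω ∈ O z} ≤
      0.9995 ^ a * (41 / 40) ^ ((a : ℤ) - b) := by
  refine (measureReal_mono ?_).trans (measureReal_reachesAbove_le (O := O ∘ g) (p := p)
    (fun v => hO _) (hind.precomp hg) (fun v => hp _) hp0 (by linarith) (by norm_num)
    (by linarith) (by norm_num) (growth_factor_le hp0 hp1) a b)
  rintro ω ⟨h1, h2⟩
  have := h1.map (P' := {v | ω ∈ (O ∘ g) v}) f
    (fun v hv => by simpa [hgf] using hv) hf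
  rw [hc, hz] at this
  exact ⟨b, le_rfl, this, by simpa [← hz, hgf] using h2⟩

/-- Exponential decay of connection probabilities in oriented triangular site percolation. -/
theorem measureReal_triConnects_le (hO : ∀ v, MeasurableSet (O v)) (hind : iIndepSet O μ)
    (hp : ∀ v, μ.real (O v) = p) (hp0 : 0 ≤ p) (hp1 : p ≤ 0.5467) (c : Site) (a b : ℕ) :
    μ.real {ω | TriConnects {v | ω ∈ O v} c (c.1 - a, c.2 + b) ∧ ω ∈ O (c.1 - a, c.2 + b)} ≤
      0.9999 ^ (2 * (a + b)) := by
  have h1 := measureReal_le_of_reachesAbove_map hO hind hp hp0 hp1 (c := c)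
    (z := (c.1 - a, c.2 + b)) a b (fun v => v - c) (fun v => v + c) (fun v => by simp)
    (add_left_injective c) (fun v u h => by simpa using h) (by simp) (by ext <;> simp)
  -- The reflection (x, y) ↦ (-y, -x) preserves the three steps and exchanges a and b. In the
  -- product of the two bounds the powers of 41/40 cancel.
  have h2 := measureReal_le_of_reachesAbove_map hO hind hp hp0 hp1 (c := c)
    (z := (c.1 - a, c.2 + b)) b a (fun v => (c.2 - v.2, c.1 - v.1))
    (fun v => (c.1 - v.2, c.2 - v.1)) (fun v => by simp)
    (fun v u h => by simp only [Prod.mk.injEq] at h; ext <;> omega)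
    (fun v u h => by
      simp only [stepsTriangular, Set.mem_insert_iff, Set.mem_singleton_iff, Prod.ext_iff,
        Prod.fst_sub, Prod.snd_sub] at h ⊢
      omega) (by simp) (by ext <;> simp)
  set x := μ.real {ω | TriConnects {v | ω ∈ O v} c (c.1 - a, c.2 + b) ∧ ω ∈ O (c.1 - a, c.2 + b)}
  have hx : 0 ≤ x := measureReal_nonneg
  refine le_of_sq_le_sq ?_ (by positivity)
  calc x ^ 2 = x * x := sq x
    _ ≤ (0.9995 ^ a * (41 / 40) ^ ((a : ℤ) - b)) * (0.9995 ^ b * (41 / 40) ^ ((b : ℤ) - a)) :=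
        mul_le_mul h1 h2 hx (by positivity)
    _ = 0.9995 ^ (a + b) * ((41 / 40) ^ ((a : ℤ) - b) * (41 / 40) ^ ((b : ℤ) - a)) := by
        rw [pow_add]; ring
    _ = 0.9995 ^ (a + b) := by
        rw [← zpow_add₀ (by norm_num)]; simp
    -- Here 0.9995 ≤ 0.9999 ^ 4. The exponent 2 (a + b) leaves a spare a + b for the sum over
    -- starting points in `ae_axisBounded`.
    _ ≤ (0.9999 ^ 4) ^ (a + b) := by gcongr; norm_num
    _ = (0.9999 ^ (2 * (a + b))) ^ 2 := by
        rw [← pow_mul, ← pow_mul]; congr 1; ring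

theorem measure_triConnects_le (hO : ∀ v, MeasurableSet (O v)) (hind : iIndepSet O μ)
    (hp : ∀ v, μ.real (O v) = p) (hp0 : 0 ≤ p) (hp1 : p ≤ 0.5467) (c : Site) (a b : ℕ) :
    μ {ω | TriConnects {v | ω ∈ O v} c (c.1 - a, c.2 + b) ∧ ω ∈ O (c.1 - a, c.2 + b)} ≤
      ENNReal.ofReal (0.9999 ^ (2 * (a + b))) := by
  rw [← ofReal_measureReal]
  exact ENNReal.ofReal_le_ofReal (measureReal_triConnects_le hO hind hp hp0 hp1 c a b)

theorem tsum_ne_top_of_le_geometric {ι : Type*} {f : ι → ENNReal} {g : ι → ℝ} (hg : Summable g)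
    (h : ∀ i, f i ≤ ENNReal.ofReal (g i)) : ∑' i, f i ≠ ⊤ :=
  ne_top_of_le_ne_top hg.tsum_ofReal_ne_top (ENNReal.tsum_le_tsum h)

theorem finite_triConnects_of_finite_open {P : Set Site} {c : Site}
    (h : {ab : ℕ × ℕ | TriConnects P c (c.1 - ab.1, c.2 + ab.2) ∧
      ((c.1 - ab.1, c.2 + ab.2) : Site) ∈ P}.Finite) : {z | TriConnects P c z}.Finite := by
  have hsteps : stepsTriangular.Finite := by simp [stepsTriangular]
  refine ((Set.finite_singleton c).union ((h.image fun ab =>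
    ((c.1 - ab.1, c.2 + ab.2) : Site)).image2 (· + ·) hsteps)).subset ?_
  intro z hz
  rcases Relation.ReflTransGen.cases_tail hz with rfl | ⟨b, hb, hbP, hbz⟩
  · exact Or.inl rfl
  · right
    obtain ⟨i, j, rfl⟩ := TriConnects.exists_displacement hb
    exact ⟨_, ⟨(i, j), ⟨hb, hbP⟩, rfl⟩, _, hbz, by simp⟩

theorem ae_triFinite (hO : ∀ v, MeasurableSet (O v)) (hind : iIndepSet O μ)
    (hp : ∀ v, μ.real (O v) = p) (hp0 : 0 ≤ p) (hp1 : p ≤ 0.5467) :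
    ∀ᵐ ω ∂μ, TriFinite {v | ω ∈ O v} := by
  refine ae_all_iff.2 fun c => ?_
  have hgeo : Summable fun n : ℕ => (0.9999 : ℝ) ^ n :=
    summable_geometric_of_lt_one (by norm_num) (by norm_num)
  have hsum : Summable fun ab : ℕ × ℕ => (0.9999 : ℝ) ^ ab.1 * 0.9999 ^ ab.2 :=
    hgeo.mul_of_nonneg hgeo (fun _ => by positivity) (fun _ => by positivity)
  have := ae_finite_setOfPred_mem (μ := μ) (s := fun ab : ℕ × ℕ =>
    {ω | TriConnects {v | ω ∈ O v} c (c.1 - ab.1, c.2 + ab.2) ∧ ω ∈ O (c.1 - ab.1, c.2 + ab.2)})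
    (tsum_ne_top_of_le_geometric hsum fun ab =>
      (measure_triConnects_le hO hind hp hp0 hp1 c ab.1 ab.2).trans (ENNReal.ofReal_le_ofReal ?_))
  · filter_upwards [this] with ω hω
    exact finite_triConnects_of_finite_open hω
  · rw [← pow_add]
    exact pow_le_pow_of_le_one (by norm_num) (by norm_num) (by omega)

/-- Borel–Cantelli over the starting point (k, 0) and the displacement (-a, b). Crossing the
diagonal means k < a + b, so 2 (a + b) ≥ k + a + b and the bounds are summable in all three indices.
-/
theorem ae_axisBounded (hO : ∀ v, MeasurableSet (O v)) (hind : iIndepSet O μ)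
    (hp : ∀ v, μ.real (O v) = p) (hp0 : 0 ≤ p) (hp1 : p ≤ 0.5467) :
    ∀ᵐ ω ∂μ, AxisBounded {v | ω ∈ O v} := by
  have hgeo : Summable fun n : ℕ => (0.9999 : ℝ) ^ n :=
    summable_geometric_of_lt_one (by norm_num) (by norm_num)
  have hsum : Summable fun i : ℕ × ℕ × ℕ =>
      (0.9999 : ℝ) ^ i.1 * (0.9999 ^ i.2.1 * 0.9999 ^ i.2.2) :=
    hgeo.mul_of_nonneg (g := fun ab : ℕ × ℕ => (0.9999 : ℝ) ^ ab.1 * 0.9999 ^ ab.2)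
      (hgeo.mul_of_nonneg hgeo (fun _ => by positivity) (fun _ => by positivity))
      (fun _ => by positivity) (fun _ => by positivity)
  have := ae_finite_setOfPred_mem (μ := μ) (s := fun i : ℕ × ℕ × ℕ =>
    {ω | i.1 < i.2.1 + i.2.2 ∧ TriConnects {v | ω ∈ O v} (i.1, 0) (i.1 - i.2.1, 0 + i.2.2) ∧
      ω ∈ O (i.1 - i.2.1, 0 + i.2.2)})
    (tsum_ne_top_of_le_geometric hsum ?_)
  · filter_upwards [this] with ω hω
    obtain ⟨n₀, hn₀⟩ := (hω.image fun i => i.1).bddAbove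
    refine ⟨n₀, fun k hk z hzP hz => ?_⟩
    obtain ⟨i, j, rfl⟩ := hz.exists_displacement
    by_contra hcon
    have hmem : k ≤ n₀ := hn₀ ⟨(k, i, j), ⟨by simp at hcon ⊢; omega, hz, hzP⟩, rfl⟩
    omega
  · rintro ⟨k, a, b⟩
    by_cases hk : k < a + b
    · refine (measure_mono fun ω hω => hω.2).trans
        ((measure_triConnects_le hO hind hp hp0 hp1 (k, 0) a b).trans
          (ENNReal.ofReal_le_ofReal ?_))
      rw [← pow_add, ← pow_add]
      exact pow_le_pow_of_le_one (by norm_num) (by norm_num) (by dsimp only; omega)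
    · simp [hk]

end Clusters

/-! ### The product law of the environment -/

section Law

theorem measurableSet_singleton_steps (A : Set Site) : MeasurableSet ({A} : Set (Set Site)) := by
  have : ({A} : Set (Set Site)) = ⋂ v : Site, {S | v ∈ S ↔ v ∈ A} := by
    ext S
    simp [Set.ext_iff]
  rw [this]
  refine MeasurableSet.iInter fun v => ?_
  have hv : Measurable fun S : Set Site => v ∈ S := measurable_set_mem v
  exact hv (MeasurableSet.of_discrete (s := {q : Prop | q ↔ v ∈ A}))

variable {A B : Set Site} (p : I)

instance : IsProbabilityMeasure (twoValuedLaw A B p) := by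
  unfold twoValuedLaw; infer_instance

theorem measurableSet_stateEvent (C : Set Site) (v : Site) : MeasurableSet {G : Env | G v = C} :=
  measurableSet_singleton_steps C |>.preimage (measurable_pi_apply v)

theorem twoValuedLaw_biInter_stateEvent (C : Set Site) (s : Finset Site) :
    twoValuedLaw A B p (⋂ v ∈ s, {G : Env | G v = C}) =
      ∏ _v ∈ s, bernoulliMeasure A B p {C} := by
  have : (⋂ v ∈ s, {G : Env | G v = C}) = Set.pi s fun _ => {C} := by
    ext G; simp [Set.mem_pi]
  rw [this, twoValuedLaw, Measure.infinitePi_pi _ fun _ _ => measurableSet_singleton_steps C]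

theorem twoValuedLaw_stateEvent (C : Set Site) (v : Site) :
    twoValuedLaw A B p {G : Env | G v = C} = bernoulliMeasure A B p {C} := by
  simpa using twoValuedLaw_biInter_stateEvent (A := A) (B := B) p C {v}

theorem iIndepSet_stateEvent (C : Set Site) :
    iIndepSet (fun v => {G : Env | G v = C}) (twoValuedLaw A B p) := by
  rw [iIndepSet_iff_meas_biInter (measurableSet_stateEvent C)]
  intro s
  simp only [twoValuedLaw_stateEvent, twoValuedLaw_biInter_stateEvent]

theorem measureReal_stateEvent_left (hAB : A ≠ B) (v : Site) :
    (twoValuedLaw A B p).real {G : Env | G v = A} = p := by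
  rw [measureReal_def, twoValuedLaw_stateEvent, ← measureReal_def]
  exact bernoulliMeasure_real_apply_of_mem_of_notMem p (measurableSet_singleton_steps A) rfl
    fun h => hAB h.symm

theorem measureReal_stateEvent_right (hAB : A ≠ B) (v : Site) :
    (twoValuedLaw A B p).real {G : Env | G v = B} = 1 - p := by
  rw [measureReal_def, twoValuedLaw_stateEvent, ← measureReal_def]
  exact bernoulliMeasure_real_apply_of_notMem_of_mem p (measurableSet_singleton_steps B)
    (fun h => hAB h) rfl

theorem ae_twoValued : ∀ᵐ G ∂(twoValuedLaw A B p), ∀ v, G v = A ∨ G v = B := by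
  refine ae_all_iff.2 fun v => ?_
  have hm : MeasurableSet ({A, B} : Set (Set Site)) := by
    rw [Set.insert_eq]
    exact (measurableSet_singleton_steps A).union (measurableSet_singleton_steps B)
  have h1 : {G : Env | G v = A ∨ G v = B} = Set.pi ({v} : Finset Site) fun _ => {A, B} := by
    ext G; simp
  refine (prob_compl_eq_zero_iff ?_).2 ?_
  · exact hm.preimage (measurable_pi_apply v)
  · rw [h1, twoValuedLaw, Measure.infinitePi_pi _ fun _ _ => hm]
    simp [hm]

end Law

/-! ### Conclusion -/

/-- The cubic q³ + 2q - 1 is increasing in q and already negative at q = 0.4533. -/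
theorem le_of_cubic_nonneg {p : ℝ} (h : 0 ≤ (1 - p) ^ 3 + 2 * (1 - p) - 1) : p ≤ 0.5467 := by
  by_contra! hcon
  nlinarith [sq_nonneg (1 - p), mul_nonneg (sub_nonneg.2 hcon.le) (sq_nonneg (1 - p)),
    sq_nonneg (1 - p + 0.4533)]

theorem stepsNE_ne_stepsSW : stepsNE ≠ stepsSW := by
  intro h
  have : ((1, 0) : Site) ∈ stepsSW := h ▸ by simp [stepsNE]
  simp [stepsSW] at this

theorem stepsTriangular_ne_empty : stepsTriangular ≠ ∅ :=
  (Set.insert_nonempty _ _).ne_empty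

theorem ae_hasGiganticComponent (p : I) (h1 : (p : ℝ) ≤ 0.5467) (h2 : 1 - (p : ℝ) ≤ 0.5467) :
    ∀ᵐ G ∂(orthantLaw p), HasGiganticComponent G := by
  have iNE := iIndepSet_stateEvent (A := stepsNE) (B := stepsSW) p stepsNE
  have iSW := iIndepSet_stateEvent (A := stepsNE) (B := stepsSW) p stepsSW
  have pNE := measureReal_stateEvent_left p stepsNE_ne_stepsSW
  have pSW := measureReal_stateEvent_right p stepsNE_ne_stepsSW
  have hq : 0 ≤ 1 - (p : ℝ) := sub_nonneg.2 p.2.2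
  have hneg : Function.Injective fun v : Site => -v := neg_injective
  have hnegswap : Function.Injective fun v : Site => -v.swap :=
    neg_injective.comp Prod.swap_injective
  unfold orthantLaw
  filter_upwards [ae_twoValued (A := stepsNE) (B := stepsSW) p,
    ae_triFinite (measurableSet_stateEvent _) iNE pNE p.2.1 h1,
    ae_triFinite (fun v => measurableSet_stateEvent _ _) (iNE.precomp Prod.swap_injective)
      (fun v => pNE _) p.2.1 h1,
    ae_triFinite (fun v => measurableSet_stateEvent _ _) (iSW.precomp hneg) (fun v => pSW _) hq h2,
    ae_triFinite (fun v => measurableSet_stateEvent _ _) (iSW.precomp hnegswap) (fun v => pSW _)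
      hq h2,
    ae_axisBounded (fun v => measurableSet_stateEvent _ _) (iNE.precomp Prod.swap_injective)
      (fun v => pNE _) p.2.1 h1,
    ae_axisBounded (fun v => measurableSet_stateEvent _ _) (iSW.precomp hnegswap) (fun v => pSW _)
      hq h2] with G hG t1 t2 t3 t4 b1 b2
  -- Almost surely a site that is not `NE` is `SW`, so the rotated chains are percolation with
  -- parameter 1 - p.
  have hcompl : {v | -v ∉ {v | G v = stepsNE}} = {v | G (-v) = stepsSW} := by
    ext v
    refine ⟨fun h => (hG _).resolve_left h, fun h h' => ?_⟩
    exact stepsNE_ne_stepsSW ((show G (-v) = stepsNE from h').symm.trans h)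
  refine hasGiganticComponent_of_boundary_chains hG ⟨t1, t2, ?_, ?_⟩ b1 ?_
  · rw [hcompl]; exact t3
  · rw [hcompl]; exact t4
  · rw [hcompl]; exact b2

theorem otspLaw_infinite_eq_zero (p : I) (hp : (p : ℝ) ≤ 0.5467) :
    otspLaw p {G | (forwardCluster G 0).Infinite} = 0 := by
  have hae : ∀ᵐ G ∂(otspLaw p), (forwardCluster G 0).Finite := by
    unfold otspLaw
    filter_upwards [ae_twoValued (A := stepsTriangular) (B := ∅) p,
      ae_triFinite (measurableSet_stateEvent _) (iIndepSet_stateEvent p stepsTriangular)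
        (measureReal_stateEvent_left p stepsTriangular_ne_empty) p.2.1 hp] with G hG hfin
    refine (hfin 0).subset fun z hz => ?_
    refine Relation.ReflTransGen.mono (fun a b (hab : b - a ∈ G a) => ?_) _ _ hz
    rcases hG a with h | h
    · exact ⟨h, h ▸ hab⟩
    · rw [h] at hab
      exact absurd hab (Set.notMem_empty _)
  simpa [ae_iff] using hae

end DegenerateEnv

theorem theorem4p13 :
    (∀ p : unitInterval, 0 ≤ (p : ℝ) ^ 3 + 2 * (p : ℝ) - 1 →
        0 ≤ (1 - (p : ℝ)) ^ 3 + 2 * (1 - (p : ℝ)) - 1 →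
        ∀ᵐ G ∂(DegenerateEnv.orthantLaw p), DegenerateEnv.HasGiganticComponent G) ∧
      (0.5466 : ℝ) ≤ (DegenerateEnv.otspCritical : ℝ) := by
  refine ⟨fun p h1 h2 => DegenerateEnv.ae_hasGiganticComponent p
    (DegenerateEnv.le_of_cubic_nonneg h2)
    (DegenerateEnv.le_of_cubic_nonneg (by simpa using h1)), ?_⟩
  have hle : (⟨0.5466, by norm_num, by norm_num⟩ : unitInterval) ≤ DegenerateEnv.otspCritical := by
    refine le_sInf fun p hp => ?_
    by_contra! hcon
    have hcon' : (p : ℝ) < 0.5466 := hcon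
    exact hp.ne' (DegenerateEnv.otspLaw_infinite_eq_zero p (by linarith))
  exact hle
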